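/- Fix a positive integer $g$, and for each positive integer $n$ let $M_n(\mathbb C)^g$ be the space of $g$-tuples $X=(X_1,\dots,X_g)$ of complex $n\times n$ matrices. A \emph{non-commutative domain} is a sequence $\mathcal D=(\mathcal D(n))_{n\ge 1}$ of open connected sets $\mathcal D(n)\subseteq M_n(\mathbb C)^g$ such that $U^*XU=(U^*X_1U,\dots,U^*X_gU)\in\mathcal D(n)$ whenever $X\in\mathcal D(n)$ and $U$ is an $n\times n$ unitary matrix, and $X\oplus Y\in\mathcal D(n+m)$ whenever $X\in\mathcal D(n)$ and $Y\in\mathcal D(m)$. It is \emph{bounded} if there is $C\in\mathbb R$ such that $C^2I_n-\sum_{j=1}^g X_jX_j^*$ is positive definite for all $n$ and all $X\in\mathcal D(n)$, and it \emph{contains $0$} if $0\in\mathcal D(n)$ for every $n$. A \emph{free map} $f:\mathcal D\to\mathcal D$ is a sequence of functions $f[n]:\mathcal D(n)\to\mathcal D(n)$ which respects intertwining maps: if $X\in\mathcal D(n)$, $Y\in\mathcal D(m)$, and $\Gamma$ is a complex $n\times m$ matrix with $X_j\Gamma=\Gamma Y_j$ for all $j$, then $f[n](X)_j\,\Gamma=\Gamma\,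 f[m](Y)_j$ for all $j$. It is \emph{continuous} (respectively \emph{analytic}) if every $f[n]$ is continuous (respectively complex analytic), and \emph{proper} if, for every $n$, the preimage under $f[n]$ of each compact subset of $\mathcal D(n)$ is compact. It is a \emph{bianalytic free map} if every $f[n]:\mathcal D(n)\to\mathcal D(n)$ is a bijection and both $f$ and $f^{-1}=(f[n]^{-1})_n$ are proper analytic free maps. \textbf{Theorem (free Carathéodory--Cartan--Kaup--Wu theorem).} Let $\mathcal D$ be a bounded non-commutative domain which contains $0$, and let $f:\mathcal D\to\mathcal D$ be a continuous free map. Let $\phi=f[1]:\mathcal D(1)\to\mathcal D(1)$, where $\mathcal D(1)\subseteq M_1(\mathbb C)^g=\mathbb C^g$, and assume that $\phi(0)=0$. Then $\phi$ is complex differentiable at $0$, and: \begin{enumerate} \item[(1)] if all the eigenvalues of $\phi'(0)$ have modulus one, then $f$ is a bianalytic free map; \item[(2)] if $\phi'(0)=I$, then $f$ is the identity, that is, $f[n](X)=X$ for all $n$ and all $X\in\mathcal D(n)$. \end{enumerate} -/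

import Mathlib

open scoped Matrix ComplexOrder

-- The entrywise sup norm. All norms on these finite-dimensional spaces are equivalent, and the
-- norm is used only for openness, continuity, derivatives and analyticity.
attribute [local instance] Matrix.normedAddCommGroup Matrix.normedSpace

namespace FreeMap

/-- The space of `g`-tuples of `n × n` complex matrices, for a positive integer `n`. -/
abbrev MatTuple (g : ℕ) (n : ℕ+) : Type := Fin g → Matrix (Fin n) (Fin n) ℂ

/-- Concatenation of index sets: the first `n` indices, followed by the last `m` indices. -/
def sumEquiv (n m : ℕ+) : Fin n ⊕ Fin m ≃ Fin (n + m : ℕ+) :=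
  finSumFinEquiv.trans (finCongr (PNat.add_coe n m).symm)

/-- The direct sum `X ⊕ Y`, the tuple of the block diagonal matrices with blocks `X j`, `Y j`. -/
def directSum {g : ℕ} {n m : ℕ+} (X : MatTuple g n) (Y : MatTuple g m) : MatTuple g (n + m) :=
  fun j => Matrix.reindex (sumEquiv n m) (sumEquiv n m) (Matrix.fromBlocks (X j) 0 0 (Y j))

/-- A non-commutative set: closed under simultaneous unitary similarity and direct sums. -/
structure IsNCSet {g : ℕ} (D : (n : ℕ+) → Set (MatTuple g n)) : Prop where
  unitary_mem : ∀ (n : ℕ+) (X : MatTuple g n) (U : Matrix (Fin n) (Fin n) ℂ),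
    X ∈ D n → U ∈ Matrix.unitaryGroup (Fin n) ℂ → (fun j => Uᴴ * X j * U) ∈ D n
  directSum_mem : ∀ (n m : ℕ+) (X : MatTuple g n) (Y : MatTuple g m),
    X ∈ D n → Y ∈ D m → directSum X Y ∈ D (n + m)

/-- A non-commutative domain: a non-commutative set with open and connected levels. -/
structure IsNCDomain {g : ℕ} (D : (n : ℕ+) → Set (MatTuple g n)) : Prop extends IsNCSet D where
  isOpen : ∀ n, IsOpen (D n)
  isConnected : ∀ n, IsConnected (D n)

/-- Boundedness, with one constant for all matrix sizes: `C² - ∑ Xⱼ Xⱼ* ≻ 0`. -/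
def IsBounded {g : ℕ} (D : (n : ℕ+) → Set (MatTuple g n)) : Prop :=
  ∃ C : ℝ, ∀ (n : ℕ+), ∀ X ∈ D n,
    (((C : ℂ) ^ 2) • (1 : Matrix (Fin n) (Fin n) ℂ) - ∑ j, X j * (X j)ᴴ).PosDef

/-- `f` is a free map on `D`, i.e. it respects intertwining maps. Only the values of `f n` on
`D n` matter. -/
def IsFreeMap {g h : ℕ} (D : (n : ℕ+) → Set (MatTuple g n))
    (f : (n : ℕ+) → MatTuple g n → MatTuple h n) : Prop :=
  ∀ (n m : ℕ+), ∀ X ∈ D n, ∀ Y ∈ D m, ∀ Γ : Matrix (Fin n) (Fin m) ℂ,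
    (∀ j, X j * Γ = Γ * Y j) → ∀ j, f n X j * Γ = Γ * f m Y j

/-- Each `f n` is continuous on `D n`. -/
def IsContinuous {g h : ℕ} (D : (n : ℕ+) → Set (MatTuple g n))
    (f : (n : ℕ+) → MatTuple g n → MatTuple h n) : Prop :=
  ∀ n, ContinuousOn (f n) (D n)

/-- Each `f n` is (complex) analytic on `D n`. -/
def IsAnalytic {g h : ℕ} (D : (n : ℕ+) → Set (MatTuple g n))
    (f : (n : ℕ+) → MatTuple g n → MatTuple h n) : Prop :=
  ∀ n, AnalyticOnNhd ℂ (f n) (D n)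

/-- Each `f n : D n → E n` is proper: preimages of compact subsets of `E n` are compact. -/
def IsProper {g h : ℕ} (D : (n : ℕ+) → Set (MatTuple g n)) (E : (n : ℕ+) → Set (MatTuple h n))
    (f : (n : ℕ+) → MatTuple g n → MatTuple h n) : Prop :=
  ∀ n, ∀ K ⊆ E n, IsCompact K → IsCompact (D n ∩ f n ⁻¹' K)

/-- A proper analytic free map from `D` into `E`. -/
structure IsProperAnalyticFreeMap {g h : ℕ} (D : (n : ℕ+) → Set (MatTuple g n))
    (E : (n : ℕ+) → Set (MatTuple h n)) (f : (n : ℕ+) → MatTuple g n → MatTuple h n) : Prop where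
  mapsTo : ∀ n, Set.MapsTo (f n) (D n) (E n)
  isFreeMap : IsFreeMap D f
  isAnalytic : IsAnalytic D f
  isProper : IsProper D E f

/-- A bianalytic free map from `D` to `E`: `f` has a two-sided inverse `E → D`, and both `f` and
its inverse are proper analytic free maps. -/
def IsBianalyticFreeMap {g : ℕ} (D E : (n : ℕ+) → Set (MatTuple g n))
    (f : (n : ℕ+) → MatTuple g n → MatTuple g n) : Prop :=
  IsProperAnalyticFreeMap D E f ∧
    ∃ finv : (n : ℕ+) → MatTuple g n → MatTuple g n,
      IsProperAnalyticFreeMap E D finv ∧ ∀ n, Set.InvOn (finv n) (f n) (D n) (E n)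

end FreeMap

/-! ### Osgood's lemma: continuity and holomorphy on complex lines give analyticity. -/

section Osgood

open Metric Set MeasureTheory Complex Filter Topology

variable {F : Type*} [NormedAddCommGroup F] [NormedSpace ℂ F]

/-! Analyticity comes from the free structure. At a block upper triangular point with diagonal
blocks `X`, `X + tV` and corner `δV`, a free map has as its corner a multiple of the difference
quotient of `f` along `V`. Continuity at level `2n` makes this converge as `t → 0`, so `f` is
complex differentiable along lines, and Osgood's lemma applies (`IsFreeMap.isAnalytic`).

Intertwining relations with the scalar level give `f[n](0) = 0` and force `f[n]'(0)` to be `A =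
φ'(0)` acting entrywise (`IsFreeMap.fderiv_zero_eq_ampliation`). This action is an algebra
homomorphism in `A`, so what is known about powers of `A` passes to every level.

Boundedness and Cauchy's estimate bound the powers of `A`. If moreover the eigenvalues are
unimodular, the powers of `A⁻¹` are bounded too and some `A ^ p i`, with `p i > 0`, tend to the
identity (`IsPowerBounded.exists_inverse`). The averages of `A⁻ᵏ ∘ fᵏ` nearly linearize `f` near
`0`, which bounds `f^N - id` there by a multiple of `‖A ^ N - 1‖` (`exists_norm_iterate_sub_le`).
Hence `f^(p i)` tends to the identity near `0`, and, by a Vitali argument based on three circles,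
locally uniformly on each level.

Such convergence makes `f` a homeomorphism of each level. The inverse is a pointwise limit of the
iterates `f^(p i - 1)`, hence free; being continuous and free, it is analytic. If `A = 1`, the
choice `p i = 1` gives `f = id`. -/

theorem torusMap_mem_sphere {n : ℕ} {c : Fin n → ℂ} {R : ℝ} (hR : 0 ≤ R) (θ : Fin n → ℝ)
    (i : Fin n) : torusMap c (fun _ => R) θ i ∈ sphere (c i) R :=
  circleMap_mem_sphere (c i) hR (θ i)

theorem continuous_torusMap {n : ℕ} (c : Fin n → ℂ) (R : Fin n → ℝ) :
    Continuous (torusMap c R) := by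
  unfold torusMap
  fun_prop

theorem sub_ne_zero_of_mem_sphere_of_mem_ball {c z w : ℂ} {R : ℝ} (hz : z ∈ sphere c R)
    (hw : w ∈ ball c R) : z - w ≠ 0 := by
  rintro h
  rw [sub_eq_zero] at h
  subst h
  exact (ne_of_lt hw) hz

/-- **Cauchy's integral formula** on a polydisc. -/
theorem torusIntegral_prod_sub_inv_smul [CompleteSpace F] {R : ℝ} (hR : 0 < R) :
    ∀ {n : ℕ} {f : (Fin n → ℂ) → F} {c w : Fin n → ℂ},
      ContinuousOn f (univ.pi fun i => closedBall (c i) R) →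
      (∀ z ∈ univ.pi fun i => closedBall (c i) R, ∀ i,
        DifferentiableOn ℂ (fun t => f (Function.update z i t)) (closedBall (c i) R)) →
      (∀ i, w i ∈ ball (c i) R) →
      (∯ z in T(c, fun _ => R), (∏ i, (z i - w i)⁻¹) • f z) = (2 * Real.pi * I : ℂ) ^ n • f w
  | 0, f, c, w, _, _, _ => by
    simp [Subsingleton.elim c w]
  | n + 1, f, c, w, hc, hd, hw => by
    have hint : TorusIntegrable (fun z => (∏ i, (z i - w i)⁻¹) • f z) c fun _ => R := by
      refine Continuous.integrableOn_Icc (Continuous.smul ?_ ?_)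
      · refine continuous_finsetProd _ fun i _ => Continuous.inv₀ ?_ fun θ => ?_
        · exact (continuous_pi_iff.1 (continuous_torusMap c _) i).sub continuous_const
        · exact sub_ne_zero_of_mem_sphere_of_mem_ball (torusMap_mem_sphere hR.le θ i) (hw i)
      · exact hc.comp_continuous (continuous_torusMap c _) fun θ i _ =>
          sphere_subset_closedBall (torusMap_mem_sphere hR.le θ i)
    rw [torusIntegral_succ hint]
    have hmem : ∀ x ∈ closedBall (c 0) R, ∀ y ∈ univ.pi fun i => closedBall ((c ∘ Fin.succ) i) R,
        (Fin.cons x y : Fin (n + 1) → ℂ) ∈ univ.pi fun i => closedBall (c i) R := by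
      intro x hx y hy i _
      refine Fin.cases ?_ (fun j => ?_) i
      · simpa using hx
      · simpa using hy j (mem_univ j)
    have hw' : (w ∘ Fin.succ) ∈ univ.pi fun i => closedBall ((c ∘ Fin.succ) i) R :=
      fun i _ => ball_subset_closedBall (hw i.succ)
    have key : ∀ x ∈ sphere (c 0) R,
        (∯ y in T(c ∘ Fin.succ, (fun _ => R) ∘ Fin.succ),
          (∏ i, ((Fin.cons x y : Fin (n + 1) → ℂ) i - w i)⁻¹) • f (Fin.cons x y)) =
        (x - w 0)⁻¹ • (2 * Real.pi * I : ℂ) ^ n • f (Fin.cons x (w ∘ Fin.succ)) := by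
      intro x hx
      have hx' := sphere_subset_closedBall hx
      rw [← torusIntegral_prod_sub_inv_smul hR (f := fun y => f (Fin.cons x y))
        (c := c ∘ Fin.succ) (w := w ∘ Fin.succ), ← torusIntegral_smul]
      · simp [Fin.prod_univ_succ, mul_smul, Function.comp_def, smul_comm (x - w 0)⁻¹]
      · refine hc.comp (Continuous.continuousOn ?_) fun y hy => hmem x hx' y hy
        exact continuous_const.finCons continuous_id
      · intro z hz i
        simpa only [Fin.cons_update, Function.comp_apply] using hd (Fin.cons x z) (hmem x hx' z hz) i.succ
      · exact fun i => hw i.succ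
    rw [circleIntegral.integral_congr hR.le key]
    simp_rw [smul_comm _ ((2 * Real.pi * I : ℂ) ^ n)]
    rw [circleIntegral.integral_smul,
      DifferentiableOn.circleIntegral_sub_inv_smul (f := fun x => f (Fin.cons x (w ∘ Fin.succ)))
        _ (hw 0), smul_smul, ← pow_succ]
    · congr 2
      exact Fin.cons_self_tail w
    · have h0 := hd (Fin.cons (w 0) (w ∘ Fin.succ)) (hmem _ (ball_subset_closedBall (hw 0)) _ hw') 0
      simpa only [Fin.update_cons_zero] using h0

/-- Integration against a continuous vector-valued weight on a compact space. -/
theorem exists_clm_integral_smul {K : Type*} [TopologicalSpace K] [CompactSpace K]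
    [MeasurableSpace K] [BorelSpace K] (μ : Measure K) [IsFiniteMeasure μ]
    [SecondCountableTopologyEither K F] (h : C(K, F)) :
    ∃ Λ : C(K, ℂ) →L[ℂ] F, ∀ φ, Λ φ = ∫ x, φ x • h x ∂μ := by
  have hi : ∀ φ : C(K, ℂ), Integrable (fun x => φ x • h x) μ := fun φ =>
    Continuous.integrable_of_hasCompactSupport (φ.continuous.smul h.continuous)
      (HasCompactSupport.of_compactSpace _)
  refine ⟨LinearMap.mkContinuous ⟨⟨fun φ => ∫ x, φ x • h x ∂μ, fun φ ψ => ?_⟩, fun a φ => ?_⟩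
    (‖h‖ * μ.real univ) fun φ => ?_, fun φ => rfl⟩
  · simp only [ContinuousMap.add_apply, add_smul]
    exact integral_add (hi φ) (hi ψ)
  · simp only [ContinuousMap.smul_apply, smul_assoc, RingHom.id_apply]
    exact integral_smul a _
  · change ‖∫ x, φ x • h x ∂μ‖ ≤ _
    calc ‖∫ x, φ x • h x ∂μ‖ ≤ (‖φ‖ * ‖h‖) * μ.real univ := by
          refine norm_integral_le_of_norm_le_const (Eventually.of_forall fun x => ?_)
          rw [norm_smul]
          gcongr
          · exact φ.norm_coe_le_norm x
          · exact h.norm_coe_le_norm x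
      _ = ‖h‖ * μ.real univ * ‖φ‖ := by ring

/-- **Osgood's lemma** in `ℂⁿ`. -/
theorem analyticAt_pi_of_continuousOn_of_differentiableOn_update [CompleteSpace F] {n : ℕ}
    {f : (Fin n → ℂ) → F} {w : Fin n → ℂ} {R : ℝ} (hR : 0 < R)
    (hc : ContinuousOn f (univ.pi fun i => closedBall (w i) R))
    (hd : ∀ z ∈ univ.pi fun i => closedBall (w i) R, ∀ i,
      DifferentiableOn ℂ (fun t => f (Function.update z i t)) (closedBall (w i) R)) :
    AnalyticAt ℂ f w := by
  let K : Set (Fin n → ℝ) := Icc 0 fun _ => 2 * Real.pi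
  have : CompactSpace K := isCompact_iff_compactSpace.1 isCompact_Icc
  let ζ : Fin n → C(K, ℂ) := fun i =>
    ⟨fun θ => torusMap w (fun _ => R) θ i, by
      exact (continuous_pi_iff.1 (continuous_torusMap w fun _ => R) i).comp continuous_subtype_val⟩
  let h : C(K, F) := ⟨fun θ => (∏ i, (R : ℂ) * exp (θ.1 i * I) * I) • f (torusMap w (fun _ => R) θ),
    by
      refine Continuous.smul (continuous_finsetProd _ fun i _ => ?_) ?_
      · exact (continuous_const.mul (continuous_exp.comp ((continuous_ofReal.comp
          ((continuous_apply i).comp continuous_subtype_val)).mul continuous_const))).mul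
          continuous_const
      exact hc.comp_continuous ((continuous_torusMap w _).comp continuous_subtype_val)
        fun θ i _ => sphere_subset_closedBall (torusMap_mem_sphere hR.le _ i)⟩
  have : IsFiniteMeasure (Measure.comap ((↑) : K → (Fin n → ℝ)) volume) := by
    refine ⟨?_⟩
    rw [(MeasurableEmbedding.subtype_coe measurableSet_Icc).comap_apply]
    exact (measure_mono (Subtype.coe_image_subset K univ)).trans_lt isCompact_Icc.measure_lt_top
  obtain ⟨Λ, hΛ⟩ := exists_clm_integral_smul (Measure.comap ((↑) : K → (Fin n → ℝ)) volume) h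
  have hunit : ∀ z : Fin n → ℂ, (∀ i, z i ∈ ball (w i) R) → ∀ i,
      ∃ u : C(K, ℂ)ˣ, (u : C(K, ℂ)) = ζ i - algebraMap ℂ C(K, ℂ) (z i) ∧
        ∀ θ, (↑u⁻¹ : C(K, ℂ)) θ = (ζ i θ - z i)⁻¹ := by
    intro z hz i
    have hne : ∀ θ : K, ζ i θ - z i ≠ 0 := fun θ =>
      sub_ne_zero_of_mem_sphere_of_mem_ball (torusMap_mem_sphere hR.le _ i) (hz i)
    refine ⟨⟨ζ i - algebraMap ℂ C(K, ℂ) (z i),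
      ⟨fun θ => (ζ i θ - z i)⁻¹, ((ζ i).continuous.sub continuous_const).inv₀ hne⟩, ?_, ?_⟩,
      rfl, fun θ => rfl⟩
    · ext θ
      simpa using mul_inv_cancel₀ (hne θ)
    · ext θ
      simpa using inv_mul_cancel₀ (hne θ)
  -- The Cauchy kernel is treated as a function of `z` with values in the Banach algebra `C(K, ℂ)`,
  -- where inversion is analytic at units. No power series has to be expanded, and integration
  -- becomes the continuous linear map `Λ`.
  have hker : AnalyticAt ℂ
      (fun z : Fin n → ℂ => ∏ i, Ring.inverse (ζ i - algebraMap ℂ C(K, ℂ) (z i))) w := by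
    refine Finset.analyticAt_fun_prod _ fun i _ => ?_
    obtain ⟨u, hu, -⟩ := hunit w (fun i => mem_ball_self hR) i
    have h1 := analyticAt_inverse (𝕜 := ℂ) u
    rw [hu] at h1
    refine AnalyticAt.fun_comp h1 (analyticAt_const.sub ?_)
    exact ((Algebra.linearMap ℂ C(K, ℂ)).toContinuousLinearMap.comp
      (ContinuousLinearMap.proj (R := ℂ) i)).analyticAt w
  have hfin : AnalyticAt ℂ (fun z : Fin n → ℂ => ((2 * Real.pi * I : ℂ) ^ n)⁻¹ •
      Λ (∏ i, Ring.inverse (ζ i - algebraMap ℂ C(K, ℂ) (z i)))) w :=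
    ((Λ.analyticAt _).fun_comp hker).const_smul
  refine hfin.congr ?_
  filter_upwards [ball_mem_nhds w hR] with z hz
  have hz' : ∀ i, z i ∈ ball (w i) R := fun i => (dist_le_pi_dist z w i).trans_lt hz
  rw [inv_smul_eq_iff₀ (pow_ne_zero _ (by simp [Real.pi_ne_zero])),
    ← torusIntegral_prod_sub_inv_smul hR hc hd hz', hΛ, torusIntegral]
  rw [← integral_subtype_comap measurableSet_Icc (μ := volume)
    (fun θ : Fin n → ℝ => (∏ i, (R : ℂ) * exp (θ i * I) * I) •
      (∏ i, (torusMap w (fun _ => R) θ i - z i)⁻¹) • f (torusMap w (fun _ => R) θ))]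
  refine integral_congr_ae (Eventually.of_forall fun θ => ?_)
  have : (∏ i, Ring.inverse (ζ i - algebraMap ℂ C(K, ℂ) (z i))) θ =
      ∏ i, (torusMap w (fun _ => R) θ i - z i)⁻¹ := by
    rw [ContinuousMap.prod_apply]
    refine Finset.prod_congr rfl fun i _ => ?_
    obtain ⟨u, hu, hu'⟩ := hunit z hz' i
    rw [← hu, Ring.inverse_unit, hu']
    rfl
  simp only [this]
  exact smul_comm _ _ _

/-- **Osgood's lemma**: a continuous function on an open subset of a finite dimensional space,
differentiable along complex lines, is analytic. -/
theorem analyticOnNhd_of_continuousOn_of_lineDifferentiable [CompleteSpace F] {E : Type*}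
    [NormedAddCommGroup E] [NormedSpace ℂ E] [FiniteDimensional ℂ E] {f : E → F} {U : Set E}
    (hU : IsOpen U) (hc : ContinuousOn f U)
    (hd : ∀ x ∈ U, ∀ v, LineDifferentiableAt ℂ f x v) : AnalyticOnNhd ℂ f U := by
  let e : E ≃L[ℂ] (Fin (Module.finrank ℂ E) → ℂ) :=
    ContinuousLinearEquiv.ofFinrankEq (by simp)
  intro x hx
  have hU' : IsOpen (e.symm ⁻¹' U) := hU.preimage e.symm.continuous
  obtain ⟨R, hR, hsub⟩ := nhds_basis_closedBall.mem_iff.1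
    (hU'.mem_nhds (show e x ∈ e.symm ⁻¹' U by simpa using hx))
  have hpi : (univ.pi fun i => closedBall (e x i) R) ⊆ e.symm ⁻¹' U := by
    rw [← closedBall_pi _ hR.le]
    exact hsub
  have key : AnalyticAt ℂ (f ∘ e.symm) (e x) := by
    refine analyticAt_pi_of_continuousOn_of_differentiableOn_update hR ?_ ?_
    · exact hc.comp e.symm.continuous.continuousOn fun z hz => hpi hz
    · intro z hz i t ht
      have hz' : Function.update z i t ∈ e.symm ⁻¹' U := by
        refine hpi fun j _ => ?_
        rcases eq_or_ne j i with rfl | hji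
        · simpa using ht
        · simpa [hji] using hz j (mem_univ j)
      have h1 := hd _ hz' (e.symm (Pi.single i 1))
      have h2 : DifferentiableAt ℂ (fun s => f (e.symm (Function.update z i t) +
          (s - t) • e.symm (Pi.single i 1))) t := by
        have h3 : DifferentiableAt ℂ (fun s => f (e.symm (Function.update z i t) +
          s • e.symm (Pi.single i 1))) (t - t) := by
          rw [sub_self]
          exact h1
        exact h3.comp (f := fun s : ℂ => s - t) t (by fun_prop)
      refine (h2.congr_of_eventuallyEq (Eventually.of_forall fun s => ?_)).differentiableWithinAt
      simp only [Function.comp_apply, ← map_smul, ← map_add]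
      congr 2
      ext j
      rcases eq_or_ne j i with rfl | hji
      · simp
      · simp [hji]
  have := key.fun_comp_of_eq ((e : E →L[ℂ] _).analyticAt x) rfl
  simpa [Function.comp_def] using this

end Osgood

/-! ### Iterates of holomorphic self-maps of a bounded domain. -/

section Holomorphic

open Metric Set Filter Topology Asymptotics

variable {E F : Type*} [NormedAddCommGroup E] [NormedSpace ℂ E] [NormedAddCommGroup F]
  [NormedSpace ℂ F]

/-- For nearby points this is the Schwarz lemma on the ball of radius `r / 2` about `y`, where `u -
u y` is at most `2 * M`. Points at distance at least `r / 2` satisfy it trivially. -/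
theorem norm_sub_le_of_differentiableOn_ball {u : E → F} {c x y : E} {r M : ℝ} (hr : 0 < r)
    (hd : DifferentiableOn ℂ u (ball c r)) (hM : ∀ z ∈ ball c r, ‖u z‖ ≤ M)
    (hx : x ∈ ball c (r / 2)) (hy : y ∈ ball c (r / 2)) :
    ‖u x - u y‖ ≤ 4 * M / r * ‖x - y‖ := by
  have hsub : ball y (r / 2) ⊆ ball c r := by
    refine ball_subset_ball' ?_
    rw [mem_ball] at hy
    linarith
  have hM0 : 0 ≤ M := (norm_nonneg _).trans (hM c (mem_ball_self hr))
  have hr2 : ball c (r / 2) ⊆ ball c r := ball_subset_ball (by linarith)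
  have hdist : ∀ z ∈ ball c r, ‖u z - u y‖ ≤ 2 * M := fun z hz =>
    (norm_sub_le _ _).trans (by linarith [hM z hz, hM y (hr2 hy)])
  by_cases hxy : x ∈ ball y (r / 2)
  · have := Complex.dist_le_div_mul_dist_of_mapsTo_ball (hd.mono hsub) (R₂ := 2 * M)
      (fun z hz => by simpa [dist_eq_norm] using hdist z (hsub hz)) hxy
    rw [dist_eq_norm, dist_eq_norm] at this
    convert this using 2
    ring
  · rw [mem_ball, not_lt, dist_eq_norm] at hxy
    calc ‖u x - u y‖ ≤ 2 * M := hdist x (hr2 hx)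
      _ = 4 * M / r * (r / 2) := by field_simp; ring
      _ ≤ _ := by gcongr

/-- A vanishing derivative gains a factor `δ / r` in the Lipschitz constant: `t ↦ u (t • x) - u (t •
y)` vanishes to second order at `0`, so the second-order Schwarz lemma, evaluated at `t = 1`,
applies. -/
theorem norm_sub_le_of_hasFDerivAt_zero {u : E → F} {x y : E} {r M δ : ℝ} (hr : 0 < r)
    (hd : DifferentiableOn ℂ u (ball 0 r)) (hM : ∀ z ∈ ball 0 r, ‖u z‖ ≤ M)
    (h0 : HasFDerivAt u (0 : E →L[ℂ] F) 0) (hδr : δ < r / 2)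
    (hx : x ∈ ball 0 δ) (hy : y ∈ ball 0 δ) :
    ‖u x - u y‖ ≤ 8 * M * δ / r ^ 2 * ‖x - y‖ := by
  have hδ : 0 < δ := pos_of_mem_ball hx
  have hM0 : 0 ≤ M := (norm_nonneg _).trans (hM 0 (mem_ball_self hr))
  rw [mem_ball_zero_iff] at hx hy
  -- The largest radius for which `t • x` and `t • y` are sure to stay in the half ball where the
  -- Lipschitz bound holds.
  set R := r / 2 / δ with hR
  have hR0 : 0 < R := by positivity
  have hmem : ∀ t ∈ ball (0 : ℂ) R, ∀ z : E, ‖z‖ < δ → t • z ∈ ball (0 : E) (r / 2) := by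
    intro t ht z hz
    rw [mem_ball_zero_iff] at ht ⊢
    rw [norm_smul]
    calc ‖t‖ * ‖z‖ ≤ ‖t‖ * δ := by gcongr
      _ < R * δ := by gcongr
      _ = r / 2 := by rw [hR]; field_simp
  have hr2 : ball (0 : E) (r / 2) ⊆ ball 0 r := ball_subset_ball (by linarith)
  have hdiff : ∀ z : E, ‖z‖ < δ → DifferentiableOn ℂ (fun t : ℂ => u (t • z)) (ball 0 R) :=
    fun z hz => hd.comp (by fun_prop) fun t ht => hr2 (hmem t ht z hz)
  have hlin : ∀ z : E, (fun t : ℂ => u (t • z) - u 0) =o[𝓝 0] (fun t : ℂ => t) := by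
    intro z
    have h1 : HasFDerivAt u (0 : E →L[ℂ] F) ((0 : ℂ) • z) := by rwa [zero_smul]
    have h2 : HasDerivAt (fun t : ℂ => u (t • z)) 0 0 := by
      simpa [Function.comp_def] using
        h1.comp_hasDerivAt (0 : ℂ) ((hasDerivAt_id (0 : ℂ)).smul_const z)
    simpa using h2.isLittleO
  have key := Complex.dist_le_mul_div_pow_of_mapsTo_ball_of_isLittleO (n := 1) (c := (0 : ℂ))
    (z := 1) (R₁ := R) (R₂ := 4 * M / r * (R * ‖x - y‖)) (f := fun t : ℂ => u (t • x) - u (t • y))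
    ((hdiff x hx).sub (hdiff y hy)) ?_ ?_ ?_
  · simp only [one_smul, zero_smul, sub_self, dist_zero_right, norm_one] at key
    refine key.trans_eq ?_
    have hRδ : R * δ = r / 2 := by rw [hR]; field_simp
    have hr' : r = 2 * (R * δ) := by linarith
    rw [hr', one_add_one_eq_two, div_pow, one_pow]
    field_simp
    ring
  · intro t ht
    simp only [zero_smul, sub_self, mem_closedBall, dist_zero_right]
    refine (norm_sub_le_of_differentiableOn_ball hr hd hM (hmem t ht x hx)
      (hmem t ht y hy)).trans ?_
    rw [← smul_sub, norm_smul]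
    gcongr
    exact (mem_ball_zero_iff.1 ht).le
  · have h1 : (fun t : ℂ => u (t • x) - u (t • y)) =o[𝓝 0] (fun t : ℂ => t) :=
      ((hlin x).sub (hlin y)).congr_left fun t => by abel
    simpa using h1.norm_right
  · rw [mem_ball_zero_iff, norm_one, hR, lt_div_iff₀ hδ]
    linarith

/-- Iterates near a fixed point are controlled by the powers of the derivative. -/
theorem exists_norm_iterate_sub_le {f : E → E} {A B : E →L[ℂ] E} {r M C : ℝ} (hr : 0 < r)
    (hd : ∀ k, DifferentiableOn ℂ f^[k] (ball 0 r))
    (hM : ∀ k, ∀ x ∈ ball 0 r, ‖f^[k] x‖ ≤ M) (h0 : f 0 = 0) (hA : HasFDerivAt f A 0)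
    (hAB : A * B = 1) (hBA : B * A = 1) (hC : ∀ k, ‖B ^ k‖ ≤ C) :
    ∃ δ > 0, δ ≤ r ∧ ∀ x ∈ ball 0 δ, ∀ N, ‖f^[N] x - x‖ ≤ 2 * (C * M) * ‖A ^ N - 1‖ := by
  have hM0 : 0 ≤ M := (norm_nonneg _).trans (hM 0 0 (mem_ball_self hr))
  have hC0 : 0 ≤ C := (norm_nonneg _).trans (hC 0)
  have hf0 : ∀ k, f^[k] 0 = 0 := fun k => Function.iterate_fixed h0 k
  have hcomm : Commute B A := hBA.trans hAB.symm
  have hBApow : ∀ k, B ^ k * A ^ k = 1 := fun k => by rw [← hcomm.mul_pow, hBA, one_pow]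
  have hABpow : ∀ k, A ^ k * B ^ k = 1 := fun k => by rw [← hcomm.symm.mul_pow, hAB, one_pow]
  set M₁ := C * M + r with hM₁
  have hM₁0 : 0 < M₁ := by positivity
  -- Makes the Lipschitz constant `8 * M₁ * δ₁ / r ^ 2` at most `1 / 2`, uniformly in the number of
  -- averaged terms.
  set δ₁ := min (r / 4) (r ^ 2 / (16 * M₁)) with hδ₁
  have hδ₁0 : 0 < δ₁ := by positivity
  have hδ₁r : δ₁ < r / 2 := (min_le_left _ _).trans_lt (by linarith)
  have hδ₁M : 8 * M₁ * δ₁ / r ^ 2 ≤ 1 / 2 := by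
    rw [div_le_iff₀ (by positivity)]
    calc 8 * M₁ * δ₁ ≤ 8 * M₁ * (r ^ 2 / (16 * M₁)) := by
          gcongr
          exact min_le_right _ _
      _ = 1 / 2 * r ^ 2 := by field_simp; norm_num
  -- All iterates share the Lipschitz constant `4 * M / r`, so every orbit starting in the `δ`-ball
  -- stays in the `δ₁`-ball.
  set δ := min δ₁ (δ₁ / (4 * M / r + 1)) with hδ
  refine ⟨δ, by positivity, (min_le_left _ _).trans (by linarith), fun x hx N => ?_⟩
  have hxδ₁ : x ∈ ball (0 : E) δ₁ := ball_subset_ball (min_le_left _ _) hx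
  have hball : ball (0 : E) δ₁ ⊆ ball 0 r := ball_subset_ball (by linarith)
  have hNx : f^[N] x ∈ ball (0 : E) δ₁ := by
    have h1 := norm_sub_le_of_differentiableOn_ball hr (hd N) (hM N)
      (ball_subset_ball hδ₁r.le hxδ₁) (mem_ball_self (half_pos hr))
    rw [hf0, sub_zero, sub_zero] at h1
    rw [mem_ball_zero_iff] at hx ⊢
    have h2 : ‖x‖ < δ₁ / (4 * M / r + 1) := hx.trans_le (min_le_right _ _)
    rw [lt_div_iff₀ (by positivity)] at h2
    nlinarith [norm_nonneg x]
  -- The average `K⁻¹ • S K` has derivative `1` at `0` and is bounded independently of `K`. It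
  -- therefore differs from the identity by a map with Lipschitz constant at most `1 / 2` on the
  -- `δ₁`-ball, which gives the lower bound `hlow`.
  let S : ℕ → E → E := fun K z => ∑ k ∈ Finset.range K, (B ^ k) (f^[k] z)
  have hterm : ∀ k, ∀ z ∈ ball (0 : E) r, ‖(B ^ k) (f^[k] z)‖ ≤ C * M := fun k z hz =>
    ((B ^ k).le_opNorm _).trans (by gcongr; exacts [hC k, hM k z hz])
  have hSnorm : ∀ K, ∀ z ∈ ball (0 : E) r, ‖S K z‖ ≤ K * (C * M) := fun K z hz =>
    (norm_sum_le_of_le _ fun k _ => hterm k z hz).trans (by simp)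
  have hlow : ∀ K : ℕ, 0 < K →
      ‖f^[N] x - x‖ ≤ 2 * ((K : ℝ)⁻¹ * ‖S K (f^[N] x) - S K x‖) := by
    intro K hK
    have hK' : (K : ℝ) ≠ 0 := by positivity
    have hKC : (K : ℂ) ≠ 0 := by exact_mod_cast hK.ne'
    let u : E → E := fun z => (K : ℂ)⁻¹ • S K z - z
    have hSd : DifferentiableOn ℂ (S K) (ball 0 r) :=
      DifferentiableOn.fun_sum fun k _ => (B ^ k).differentiable.comp_differentiableOn (hd k)
    have hud : DifferentiableOn ℂ u (ball 0 r) := (hSd.const_smul _).sub differentiableOn_id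
    have hu0 : HasFDerivAt u (0 : E →L[ℂ] E) 0 := by
      have h1 : HasFDerivAt (S K) (∑ k ∈ Finset.range K, (B ^ k) ∘L (A ^ k)) 0 := by
        refine HasFDerivAt.fun_sum fun k _ => ?_
        exact (B ^ k).hasFDerivAt.comp (0 : E) (hA.iterate h0 k)
      have h2 : ∑ k ∈ Finset.range K, (B ^ k) ∘L (A ^ k) = (K : ℂ) • (1 : E →L[ℂ] E) := by
        rw [Finset.sum_congr rfl fun k _ => show (B ^ k) ∘L (A ^ k) = 1 from hBApow k]
        simp [Nat.cast_smul_eq_nsmul]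
      rw [h2] at h1
      have h3 := (h1.const_smul (K : ℂ)⁻¹).sub (hasFDerivAt_id (0 : E))
      rw [inv_smul_smul₀ hKC] at h3
      exact h3.congr_fderiv (sub_self _)
    have huM : ∀ z ∈ ball (0 : E) r, ‖u z‖ ≤ M₁ := by
      intro z hz
      refine (norm_sub_le _ _).trans (add_le_add ?_ (mem_ball_zero_iff.1 hz).le)
      rw [norm_smul, norm_inv, Complex.norm_natCast, inv_mul_le_iff₀ (by positivity)]
      exact hSnorm K z hz
    have h4 := norm_sub_le_of_hasFDerivAt_zero hr hud huM hu0 hδ₁r hNx hxδ₁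
    have h5 : ‖u (f^[N] x) - u x‖ ≤ 1 / 2 * ‖f^[N] x - x‖ := h4.trans (by gcongr)
    have h6 : f^[N] x - x = (K : ℂ)⁻¹ • (S K (f^[N] x) - S K x) - (u (f^[N] x) - u x) := by
      simp only [u, smul_sub]
      abel
    have h7 : ‖f^[N] x - x‖ ≤ (K : ℝ)⁻¹ * ‖S K (f^[N] x) - S K x‖ + ‖u (f^[N] x) - u x‖ := by
      conv_lhs => rw [h6]
      refine (norm_sub_le _ _).trans_eq ?_
      rw [norm_smul, norm_inv, Complex.norm_natCast]
    linarith
  have hup : ∀ K : ℕ, ‖S K (f^[N] x) - S K x‖ ≤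
      K * (C * M) * ‖A ^ N - 1‖ + ‖A ^ N‖ * (2 * N * (C * M)) := by
    intro K
    -- Precomposing with `f^[N]` shifts the summation index, so up to the factor `A ^ N` only the
    -- first and last `N` terms change. Their contribution disappears after division by `K` as `K →
    -- ∞`.
    have hshift : S K (f^[N] x) = (A ^ N) (S (N + K) x - S N x) := by
      simp only [S, Finset.sum_range_add, add_sub_cancel_left, map_sum]
      refine Finset.sum_congr rfl fun k _ => ?_
      rw [← Function.iterate_add_apply, pow_add, ← mul_apply_eq_comp (A ^ N),
        ← mul_assoc, hABpow, one_mul, add_comm]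
    have h1 : S K (f^[N] x) - S K x = (A ^ N - 1) (S K x) +
        (A ^ N) ((S (N + K) x - S K x) - S N x) := by
      rw [hshift]
      simp only [map_sub, sub_apply, one_apply_eq_self]
      abel
    have hxr := hball hxδ₁
    have h2 : ‖S (N + K) x - S K x‖ ≤ N * (C * M) := by
      rw [add_comm N K]
      simp only [S, Finset.sum_range_add, add_sub_cancel_left]
      exact (norm_sum_le_of_le _ fun k _ => hterm _ x hxr).trans (by simp)
    rw [h1]
    refine (norm_add_le _ _).trans (add_le_add ?_ ?_)
    · refine ((A ^ N - 1).le_opNorm _).trans ?_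
      rw [mul_comm]
      gcongr
      exact hSnorm K x hxr
    · refine ((A ^ N).le_opNorm _).trans ?_
      gcongr
      refine (norm_sub_le _ _).trans ?_
      linarith [hSnorm N x hxr]
  have hlim : Tendsto (fun K : ℕ => 2 * (C * M) * ‖A ^ N - 1‖ +
      2 * (‖A ^ N‖ * (2 * N * (C * M))) * (K : ℝ)⁻¹) atTop
      (𝓝 (2 * (C * M) * ‖A ^ N - 1‖ + 2 * (‖A ^ N‖ * (2 * N * (C * M))) * 0)) :=
    tendsto_const_nhds.add (tendsto_const_nhds.mul tendsto_inv_atTop_nhds_zero_nat)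
  rw [mul_zero, add_zero] at hlim
  refine ge_of_tendsto hlim ?_
  filter_upwards [eventually_gt_atTop 0] with K hK
  refine (hlow K hK).trans ?_
  calc 2 * ((K : ℝ)⁻¹ * ‖S K (f^[N] x) - S K x‖)
      ≤ 2 * ((K : ℝ)⁻¹ * (K * (C * M) * ‖A ^ N - 1‖ + ‖A ^ N‖ * (2 * N * (C * M)))) := by
        gcongr
        exact hup K
    _ = _ := by field_simp

open Complex.HadamardThreeLines in
/-- A version of **Hadamard's three circles theorem**. -/
theorem norm_le_rpow_mul_rpow_of_differentiableOn_ball {h : E → F} {y z : E} {δ R' R m M : ℝ}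
    (hδ : 0 < δ) (hδR : δ < R') (hR : R' < R) (hd : DifferentiableOn ℂ h (ball y R))
    (hM : ∀ w ∈ ball y R, ‖h w‖ ≤ M) (hm : ∀ w ∈ ball y δ, ‖h w‖ ≤ m) (hz : z ∈ ball y R') :
    ‖h z‖ ≤ m ^ (1 - Real.log (R' / δ) / Real.log (R / δ)) *
      M ^ (Real.log (R' / δ) / Real.log (R / δ)) := by
  have hR'0 : 0 < R' := hδ.trans hδR
  have hR0 : 0 < R := hR'0.trans hR
  set l := Real.log (δ / R') with hl
  set u := Real.log (R / R') with hu
  have hl0 : l < 0 := Real.log_neg (by positivity) ((div_lt_one hR'0).2 hδR)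
  have hu0 : 0 < u := Real.log_pos ((one_lt_div hR'0).2 hR)
  rw [mem_ball, dist_eq_norm] at hz
  -- The exponential turns the three circles into three vertical lines, with `z` at `s = 0`; the
  -- three lines theorem then applies on the strip `l ≤ re s ≤ u`.
  let g : ℂ → F := fun s => h (y + Complex.exp s • (z - y))
  have hnorm : ∀ (s : ℂ) (ρ : ℝ), 0 < ρ → s.re ≤ Real.log (ρ / R') →
      y + Complex.exp s • (z - y) ∈ ball y ρ := by
    intro s ρ hρ hs
    rw [mem_ball, dist_eq_norm, add_sub_cancel_left, norm_smul, Complex.norm_exp]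
    calc Real.exp s.re * ‖z - y‖ ≤ ρ / R' * ‖z - y‖ := by
          gcongr
          exact (Real.le_log_iff_exp_le (by positivity)).1 hs
      _ < ρ / R' * R' := by gcongr
      _ = ρ := by field_simp
  have hgd : DiffContOnCl ℂ g (verticalStrip l u) := by
    have : DifferentiableOn ℂ g (verticalClosedStrip l u) :=
      hd.comp (by fun_prop) fun s hs => hnorm s R hR0 hs.2
    refine (this.mono ?_).diffContOnCl
    rw [verticalClosedStrip]
    exact closure_minimal (preimage_mono Ioo_subset_Icc_self)
      (isClosed_Icc.preimage Complex.continuous_re)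
  have key := norm_le_interp_of_mem_verticalClosedStrip' (f := g) (z := 0) (a := m) (b := M)
    (hl0.trans hu0) ⟨hl0.le, hu0.le⟩ hgd ?_ ?_ ?_
  · have hg0 : g 0 = h z := by simp [g]
    have hexp : ((0 : ℂ).re - l) / (u - l) = Real.log (R' / δ) / Real.log (R / δ) := by
      rw [hl, hu, Real.log_div hδ.ne' hR'0.ne', Real.log_div hR0.ne' hR'0.ne',
        Real.log_div hR'0.ne' hδ.ne', Real.log_div hR0.ne' hδ.ne', Complex.zero_re]
      congr 1 <;> ring
    rwa [hg0, hexp] at key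
  · refine ⟨M, ?_⟩
    rintro _ ⟨s, hs, rfl⟩
    exact hM _ (hnorm s R hR0 hs.2)
  · intro s hs
    exact hm _ (hnorm s δ hδ (le_of_eq hs))
  · intro s hs
    exact hM _ (hnorm s R hR0 (le_of_eq hs))

theorem tendstoUniformlyOn_zero_ball_of_subball {ι : Type*} {l : Filter ι} {h : ι → E → F} {y : E}
    {δ R' R M : ℝ} (hδ : 0 < δ) (hR : R' < R) (hd : ∀ i, DifferentiableOn ℂ (h i) (ball y R))
    (hM : ∀ i, ∀ w ∈ ball y R, ‖h i w‖ ≤ M) (hl : TendstoUniformlyOn h 0 l (ball y δ)) :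
    TendstoUniformlyOn h 0 l (ball y R') := by
  rcases le_or_gt R' δ with hδR | hδR
  · exact hl.mono (ball_subset_ball hδR)
  set θ := Real.log (R' / δ) / Real.log (R / δ) with hθ
  have hθ1 : 0 < 1 - θ := by
    have h1 : 1 < R / δ := (one_lt_div hδ).2 (hδR.trans hR)
    have h2 : R' / δ < R / δ := by gcongr
    rw [sub_pos, div_lt_one (Real.log_pos h1)]
    exact Real.log_lt_log (div_pos (hδ.trans hδR) hδ) h2
  rw [Metric.tendstoUniformlyOn_iff] at hl ⊢
  intro η hη
  have hcont : Tendsto (fun ε : ℝ => ε ^ (1 - θ) * M ^ θ) (𝓝[>] 0) (𝓝 0) := by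
    have h1 : Tendsto (fun ε : ℝ => ε ^ (1 - θ) * M ^ θ) (𝓝 0) (𝓝 (0 ^ (1 - θ) * M ^ θ)) :=
      ((Real.continuousAt_rpow_const 0 (1 - θ) (Or.inr hθ1.le)).tendsto).mul_const _
    rw [Real.zero_rpow hθ1.ne', zero_mul] at h1
    exact h1.mono_left nhdsWithin_le_nhds
  obtain ⟨ε, hεη, hε⟩ := ((hcont.eventually (gt_mem_nhds hη)).and self_mem_nhdsWithin).exists
  filter_upwards [hl ε (mem_Ioi.1 hε)] with i hi z hz
  simp only [Pi.zero_apply, dist_zero_left] at hi ⊢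
  exact (norm_le_rpow_mul_rpow_of_differentiableOn_ball hδ hδR hR (hd i) (hM i)
    (fun w hw => (hi w hw).le) hz).trans_lt hεη

/-- A case of **Vitali's theorem**. -/
theorem exists_tendstoUniformlyOn_zero_ball {ι : Type*} {l : Filter ι} {h : ι → E → F} {D : Set E}
    {M : ℝ} (hD : IsOpen D) (hDc : IsPreconnected D) (hd : ∀ i, DifferentiableOn ℂ (h i) D)
    (hM : ∀ i, ∀ w ∈ D, ‖h i w‖ ≤ M) {x₀ : E} (hx₀ : x₀ ∈ D) {δ : ℝ} (hδ : 0 < δ)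
    (hl : TendstoUniformlyOn h 0 l (ball x₀ δ)) {x : E} (hx : x ∈ D) :
    ∃ r > 0, TendstoUniformlyOn h 0 l (ball x r) := by
  -- This set is open and relatively closed in `D`. For closedness, a point of `S` within `ε / 4` of
  -- `x` has a ball in `D` large enough for three circles to carry the convergence to a
  -- neighbourhood of `x`.
  let S : Set E := {x | ∃ r > 0, TendstoUniformlyOn h 0 l (ball x r)}
  suffices D ⊆ S from this hx
  refine hDc.subset_of_closure_inter_subset ?_ ⟨x₀, hx₀, δ, hδ, hl⟩ ?_
  · rw [Metric.isOpen_iff]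
    rintro x ⟨r, hr, hxr⟩
    refine ⟨r / 2, half_pos hr, fun y hy => ⟨r / 2, half_pos hr, hxr.mono ?_⟩⟩
    refine ball_subset_ball' ?_
    rw [mem_ball] at hy
    linarith
  · rintro x ⟨hxS, hxD⟩
    obtain ⟨ε, hε, hεD⟩ := Metric.isOpen_iff.1 hD x hxD
    obtain ⟨y, ⟨r, hr, hy⟩, hxy⟩ := Metric.mem_closure_iff.1 hxS (ε / 4) (by positivity)
    have hsub : ball y (3 * ε / 4) ⊆ D := by
      refine (ball_subset_ball' ?_).trans hεD
      rw [dist_comm]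
      linarith
    refine ⟨ε / 4, by positivity, (tendstoUniformlyOn_zero_ball_of_subball hr
      (show ε / 2 < 3 * ε / 4 by linarith) (fun i => (hd i).mono hsub)
      (fun i w hw => hM i w (hsub hw)) hy).mono ?_⟩
    refine ball_subset_ball' ?_
    linarith

/-- The powers of an operator are bounded. -/
def IsPowerBounded (A : E →L[ℂ] E) : Prop := ∃ C, ∀ k, ‖A ^ k‖ ≤ C

/-- By the chain rule `A ^ N` is the derivative of `f^[N]` at `0`, and all iterates obey the same
bound `M`, so Cauchy's estimate is uniform in `N`. -/
theorem isPowerBounded_of_hasFDerivAt {f : E → E} {D : Set E} {A : E →L[ℂ] E} {M : ℝ}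
    (hD : D ∈ 𝓝 0) (hDM : ∀ x ∈ D, ‖x‖ ≤ M) (hself : MapsTo f D D)
    (hd : ∀ k, DifferentiableOn ℂ f^[k] D) (h0 : f 0 = 0) (hA : HasFDerivAt f A 0) :
    IsPowerBounded A := by
  obtain ⟨r, hr, hrD⟩ := Metric.mem_nhds_iff.1 hD
  refine ⟨M / r, fun N => ?_⟩
  rw [← (hA.iterate h0 N).fderiv]
  refine Complex.norm_fderiv_le_div_of_mapsTo_ball ((hd N).mono hrD) (fun x hx => ?_) hr
  rw [Function.iterate_fixed h0, mem_closedBall_zero_iff]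
  exact hDM _ (hself.iterate N (hrD hx))

/-- If powers of the derivative at a fixed point converge to the identity, so do the corresponding
iterates, locally uniformly. -/
theorem exists_tendstoUniformlyOn_iterate_ball {f : E → E} {D : Set E} {A B : E →L[ℂ] E} {M : ℝ}
    (hD : IsOpen D) (hDc : IsPreconnected D) (hDM : ∀ x ∈ D, ‖x‖ ≤ M) (hD0 : 0 ∈ D)
    (hself : MapsTo f D D) (hd : ∀ k, DifferentiableOn ℂ f^[k] D) (h0 : f 0 = 0)
    (hA : HasFDerivAt f A 0) (hAB : A * B = 1) (hBA : B * A = 1) (hB : IsPowerBounded B)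
    {ι : Type*} {l : Filter ι} {p : ι → ℕ} (hp : Tendsto (fun i => A ^ p i) l (𝓝 1)) {x : E}
    (hx : x ∈ D) :
    ∃ r > 0, TendstoUniformlyOn (fun i y => f^[p i] y - y) 0 l (ball x r) := by
  obtain ⟨r, hr, hrD⟩ := Metric.isOpen_iff.1 hD 0 hD0
  obtain ⟨C, hC⟩ := hB
  have hmaps : ∀ k, ∀ x ∈ D, ‖f^[k] x‖ ≤ M := fun k x hx => hDM _ (hself.iterate k hx)
  obtain ⟨δ, hδ, -, hbound⟩ := exists_norm_iterate_sub_le hr (fun k => (hd k).mono hrD)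
    (fun k x hx => hmaps k x (hrD hx)) h0 hA hAB hBA hC
  refine exists_tendstoUniformlyOn_zero_ball (M := M + M) hD hDc
    (fun i => (hd (p i)).sub differentiableOn_id)
    (fun i w hw => (norm_sub_le _ _).trans (add_le_add (hmaps _ w hw) (hDM w hw))) hD0 hδ ?_ hx
  have hlim : Tendsto (fun i => 2 * (C * M) * ‖A ^ p i - 1‖) l (𝓝 0) := by
    have := ((hp.sub_const 1).norm).const_mul (2 * (C * M))
    simpa using this
  rw [Metric.tendstoUniformlyOn_iff]
  intro ε hε
  filter_upwards [hlim.eventually (gt_mem_nhds hε)] with i hi z hz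
  simp only [Pi.zero_apply, dist_zero_left]
  exact (hbound z hz (p i)).trans_lt hi

theorem approximatesLinearOn_id_of_norm_sub_le {h : E → E} {x : E} {r ε : ℝ} (hr : 0 < r)
    (hd : DifferentiableOn ℂ h (ball x r)) (hε : ∀ y ∈ ball x r, ‖h y - y‖ ≤ ε)
    (hεr : 8 * ε ≤ r) :
    ApproximatesLinearOn h (ContinuousLinearEquiv.refl ℂ E : E →L[ℂ] E) (ball x (r / 2))
      (1 / 2) := by
  intro y hy z hz
  have h1 := norm_sub_le_of_differentiableOn_ball hr (hd.sub differentiableOn_id) hε hy hz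
  have h2 : h y - h z - (ContinuousLinearEquiv.refl ℂ E : E →L[ℂ] E) (y - z) =
      (h y - y) - (h z - z) := by
    simp only [ContinuousLinearEquiv.coe_coe, ContinuousLinearEquiv.refl_apply]
    abel
  rw [h2]
  refine h1.trans ?_
  have h3 : 4 * ε / r ≤ 1 / 2 := by
    rw [div_le_iff₀ hr]
    linarith
  push_cast
  gcongr

/-- A holomorphic map uniformly close to the identity is a Lipschitz-small perturbation of it on a
smaller ball, so the quantitative inverse function theorem gives both openness at `x` and a preimage
of `x`. -/
theorem image_mem_nhds_of_norm_sub_le [CompleteSpace E] {h : E → E} {x : E} {r ε : ℝ} (hr : 0 < r)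
    (hd : DifferentiableOn ℂ h (ball x r)) (hε : ∀ y ∈ ball x r, ‖h y - y‖ ≤ ε)
    (hεr : 16 * ε < r) {s : Set E} (hs : s ∈ 𝓝 x) :
    h '' s ∈ 𝓝 (h x) ∧ x ∈ h '' (ball x r) := by
  have happ := approximatesLinearOn_id_of_norm_sub_le hr hd hε
    (by linarith [(norm_nonneg _).trans (hε x (mem_ball_self hr))])
  let σ : (ContinuousLinearEquiv.refl ℂ E : E →L[ℂ] E).NonlinearRightInverse :=
    { toFun := id, nnnorm := 1, bound' := fun y => by simp, right_inv' := fun y => rfl }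
  refine ⟨?_, ?_⟩
  · have := happ.map_nhds_eq σ (ball_mem_nhds x (half_pos hr)) (Or.inr ?_)
    · rw [← this]
      exact image_mem_map hs
    · change (1 / 2 : NNReal) < 1⁻¹
      rw [inv_one]
      exact NNReal.half_lt_self one_ne_zero
  · have hr4 : closedBall x (r / 4) ⊆ ball x (r / 2) := closedBall_subset_ball (by linarith)
    have hsurj := happ.surjOn_closedBall_of_nonlinearRightInverse σ (by positivity) hr4
    obtain ⟨y, hy, hyx⟩ := hsurj (a := x) (by
      rw [mem_closedBall, dist_comm, dist_eq_norm]
      refine (hε x (mem_ball_self hr)).trans ?_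
      change ε ≤ (((1 : NNReal) : ℝ)⁻¹ - ((1 / 2 : NNReal) : ℝ)) * (r / 4)
      push_cast
      linarith)
    exact ⟨y, ball_subset_ball (by linarith) (hr4 hy), hyx⟩

/-- A self-map some of whose iterates converge locally uniformly to the identity is a
homeomorphism. -/
theorem exists_continuousOn_inverse_of_tendstoUniformlyOn_iterate [CompleteSpace E] {f : E → E}
    {D : Set E} (hD : IsOpen D) (hself : MapsTo f D D) (hd : ∀ k, DifferentiableOn ℂ f^[k] D)
    {p : ℕ → ℕ} (hp : ∀ i, 0 < p i)
    (hl : ∀ x ∈ D, ∃ r > 0, TendstoUniformlyOn (fun i y => f^[p i] y - y) 0 atTop (ball x r)) :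
    ∃ g : E → E, MapsTo g D D ∧ InvOn g f D D ∧ ContinuousOn g D := by
  have hpt : ∀ x ∈ D, Tendsto (fun i => f^[p i] x) atTop (𝓝 x) := by
    intro x hx
    obtain ⟨r, hr, h⟩ := hl x hx
    have := (h.tendsto_at (mem_ball_self hr)).add_const x
    simpa using this
  have hinj : InjOn f D := by
    intro x hx y hy hxy
    refine tendsto_nhds_unique (hpt x hx) ((hpt y hy).congr fun i => ?_)
    obtain ⟨k, hk⟩ := Nat.exists_eq_succ_of_ne_zero (hp i).ne'
    rw [hk, Function.iterate_succ_apply, Function.iterate_succ_apply, hxy]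
  have hloc : ∀ x ∈ D, ∃ i, ∀ s ∈ 𝓝 x, f^[p i] '' s ∈ 𝓝 (f^[p i] x) ∧ x ∈ f^[p i] '' D := by
    intro x hx
    obtain ⟨r, hr, h⟩ := hl x hx
    obtain ⟨ρ, hρ, hρD⟩ := Metric.isOpen_iff.1 hD x hx
    have hσ : 0 < min r ρ := lt_min hr hρ
    obtain ⟨i, hi⟩ := ((Metric.tendstoUniformlyOn_iff.1 h) (min r ρ / 32) (by positivity)).exists
    refine ⟨i, fun s hs => ?_⟩
    have hsub : ball x (min r ρ) ⊆ D := (ball_subset_ball (min_le_right _ _)).trans hρD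
    have := image_mem_nhds_of_norm_sub_le hσ ((hd (p i)).mono hsub) (ε := min r ρ / 32)
      (fun y hy => by
        simpa only [Pi.zero_apply, dist_zero_left] using
          (hi y (ball_subset_ball (min_le_left _ _) hy)).le)
      (by linarith) hs
    exact ⟨this.1, image_mono hsub this.2⟩
  have hsurj : SurjOn f D D := by
    intro x hx
    obtain ⟨i, hi⟩ := hloc x hx
    obtain ⟨-, y, hy, hyx⟩ := hi univ univ_mem
    obtain ⟨k, hk⟩ := Nat.exists_eq_succ_of_ne_zero (hp i).ne'
    rw [hk, Function.iterate_succ_apply'] at hyx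
    exact ⟨f^[k] y, hself.iterate k hy, hyx⟩
  have hbij : BijOn f D D := ⟨hself, hinj, hsurj⟩
  obtain ⟨g, hg⟩ : ∃ g, InvOn g f D D := ⟨_, hbij.invOn_invFunOn⟩
  have hgmaps : MapsTo g D D := by
    intro y hy
    obtain ⟨x, hx, rfl⟩ := hsurj hy
    rwa [hg.1 hx]
  refine ⟨g, hgmaps, hg, fun y hy => ContinuousAt.continuousWithinAt ?_⟩
  obtain ⟨x, hx, rfl⟩ := hsurj hy
  rw [ContinuousAt, hg.1 hx]
  intro s hs
  -- Continuity of `g` uses openness of the iterate `f^[k + 1]` at `x`, not of `f`. For `y` near `f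
  -- x`, `f^[k] y` equals `f^[k] (f a)` for some `a ∈ s`, and injectivity of `f^[k]` gives `y = f
  -- a`.
  obtain ⟨i, hi⟩ := hloc x hx
  obtain ⟨k, hk⟩ := Nat.exists_eq_succ_of_ne_zero (hp i).ne'
  have himg := (hi (s ∩ D) (inter_mem hs (hD.mem_nhds hx))).1
  rw [hk, Function.iterate_succ_apply] at himg
  have hcont : ContinuousAt f^[k] (f x) :=
    (hd k).continuousOn.continuousAt (hD.mem_nhds (hself hx))
  change ∀ᶠ y in 𝓝 (f x), g y ∈ s
  filter_upwards [hcont.preimage_mem_nhds himg, hD.mem_nhds (hself hx)] with y hy hyD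
  obtain ⟨a, ⟨has, haD⟩, hay⟩ := hy
  rw [Function.iterate_succ_apply] at hay
  have hinjk : InjOn f^[k] D := hinj.iterate hself k
  rw [← hinjk (hself haD) hyD hay, hg.1 haD]
  exact has

end Holomorphic

/-! ### Power bounded operators with unimodular spectrum. -/

section Unimodular

open Filter Topology

variable {E : Type*} [NormedAddCommGroup E] [NormedSpace ℂ E] [FiniteDimensional ℂ E]

theorem norm_det_eq_one_of_forall_hasEigenvalue {A : E →L[ℂ] E}
    (h : ∀ μ : ℂ, Module.End.HasEigenvalue (A : E →ₗ[ℂ] E) μ → ‖μ‖ = 1) : ‖A.det‖ = 1 := by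
  have h1 : A.det = (A : E →ₗ[ℂ] E).charpoly.roots.prod :=
    Module.End.det_eq_prod_roots_charpoly_of_splits (IsAlgClosed.splits _)
  rw [h1]
  refine Multiset.prod_induction (fun z : ℂ => ‖z‖ = 1) _ (fun a b ha hb => ?_) norm_one
    fun z hz => ?_
  · rw [norm_mul, ha, hb, one_mul]
  · exact h z ((Module.End.hasEigenvalue_iff_isRoot_charpoly _ _).2
      (Polynomial.isRoot_of_mem_roots hz))

theorem isUnit_of_det_ne_zero {A : E →L[ℂ] E} (h : A.det ≠ 0) : IsUnit A := by
  refine ⟨(ContinuousLinearEquiv.unitsEquiv ℂ E).symm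
    (A.toContinuousLinearEquivOfDetNeZero h), ?_⟩
  ext x
  rfl

/-- A power bounded operator with unimodular eigenvalues has a power bounded inverse, and the
identity is a limit of its powers. -/
theorem IsPowerBounded.exists_inverse {A : E →L[ℂ] E}
    (h : ∀ μ : ℂ, Module.End.HasEigenvalue (A : E →ₗ[ℂ] E) μ → ‖μ‖ = 1)
    (hA : IsPowerBounded A) :
    ∃ B : E →L[ℂ] E, A * B = 1 ∧ B * A = 1 ∧ IsPowerBounded B ∧
      ∃ p : ℕ → ℕ, (∀ i, 0 < p i) ∧ Tendsto (fun i => A ^ p i) atTop (𝓝 1) := by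
  obtain ⟨C, hC⟩ := hA
  -- A compact set of invertible operators containing all powers of `A`; inversion is continuous on
  -- it, hence bounded.
  let K : Set (E →L[ℂ] E) := Metric.closedBall 0 C ∩ {X | ‖X.det‖ = 1}
  have hK : IsCompact K := (isCompact_closedBall _ _).inter_right
    (isClosed_eq ContinuousLinearMap.continuous_det.norm continuous_const)
  have hunit : ∀ X ∈ K, IsUnit X := fun X hX => isUnit_of_det_ne_zero fun h0 => by
    have := hX.2
    simp [h0] at this
  have hAK : ∀ N, A ^ N ∈ K := by
    intro N
    refine ⟨by simpa using hC N, ?_⟩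
    have : (A ^ N).det = A.det ^ N := by
      simp only [ContinuousLinearMap.det, ContinuousLinearMap.toLinearMap_pow, map_pow]
    simp [this, norm_det_eq_one_of_forall_hasEigenvalue h]
  have : CompleteSpace E := FiniteDimensional.complete ℂ E
  have hcont : ∀ X ∈ K, ContinuousAt Ring.inverse X := by
    intro X hX
    obtain ⟨u, rfl⟩ := hunit X hX
    exact NormedRing.inverse_continuousAt u
  obtain ⟨C', hC'⟩ := (hK.image_of_continuousOn
    fun X hX => (hcont X hX).continuousWithinAt).isBounded.exists_norm_le
  have hA : IsUnit A := by simpa using hunit _ (hAK 1)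
  refine ⟨Ring.inverse A, Ring.mul_inverse_cancel _ hA, Ring.inverse_mul_cancel _ hA,
    ⟨C', fun k => ?_⟩, ?_⟩
  · rw [Ring.inverse_pow]
    exact hC' _ ⟨_, hAK k, rfl⟩
  · obtain ⟨X, hX, φ, hφ, hlim⟩ := hK.tendsto_subseq hAK
    -- Quotients of consecutive terms of a convergent subsequence of powers tend to `X * X⁻¹ = 1`.
    refine ⟨fun i => φ (i + 1) - φ i, fun i => Nat.sub_pos_of_lt (hφ (Nat.lt_succ_self i)), ?_⟩
    have h1 : Tendsto (fun i => A ^ φ (i + 1) * Ring.inverse (A ^ φ i)) atTop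
        (𝓝 (X * Ring.inverse X)) :=
      (hlim.comp (tendsto_add_atTop_nat 1)).mul ((hcont X hX).tendsto.comp hlim)
    rw [Ring.mul_inverse_cancel _ (hunit X hX)] at h1
    refine h1.congr fun i => ?_
    conv_lhs => rw [← Nat.sub_add_cancel (hφ (Nat.lt_succ_self i)).le, pow_add]
    rw [mul_assoc, Ring.mul_inverse_cancel _ (hunit _ (hAK _)), mul_one]

section Map

variable {F : Type*} [NormedAddCommGroup F] [NormedSpace ℂ F]

theorem IsPowerBounded.map {B : E →L[ℂ] E} (hB : IsPowerBounded B)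
    (T : (E →L[ℂ] E) →ₐ[ℂ] (F →L[ℂ] F)) : IsPowerBounded (T B) := by
  obtain ⟨C, hC⟩ := hB
  let T' := T.toLinearMap.toContinuousLinearMap
  refine ⟨‖T'‖ * C, fun k => ?_⟩
  rw [← map_pow]
  exact (T'.le_opNorm _).trans (by gcongr; exact hC k)

theorem tendsto_algHom_pow {A : E →L[ℂ] E} {ι : Type*} {l : Filter ι} {p : ι → ℕ}
    (hp : Tendsto (fun i => A ^ p i) l (𝓝 1)) (T : (E →L[ℂ] E) →ₐ[ℂ] (F →L[ℂ] F)) :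
    Tendsto (fun i => T A ^ p i) l (𝓝 1) := by
  have hT : Continuous T := T.toLinearMap.continuous_of_finiteDimensional
  have := (hT.tendsto 1).comp hp
  simpa [Function.comp_def] using this

end Map

end Unimodular

/-! ### Free maps on block triangular tuples, and their analyticity. -/

namespace FreeMap

open Filter Topology Matrix

/-- The tuple of block upper triangular matrices with diagonal blocks `X j`, `Y j` and upper right
block `H j`. -/
def upperBlock {g : ℕ} {n : ℕ+} (X H Y : MatTuple g n) : MatTuple g (n + n) :=
  fun j => Matrix.reindex (sumEquiv n n) (sumEquiv n n) (Matrix.fromBlocks (X j) (H j) 0 (Y j))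

/-- The upper right block. -/
def upperRight {g : ℕ} {n : ℕ+} (Z : MatTuple g (n + n)) : MatTuple g n :=
  fun j => Matrix.of fun a b => Z j (sumEquiv n n (Sum.inl a)) (sumEquiv n n (Sum.inr b))

variable {g h : ℕ}

theorem upperBlock_zero {n : ℕ+} (X Y : MatTuple g n) : upperBlock X 0 Y = directSum X Y := rfl

theorem continuous_upperBlock {n : ℕ+} :
    Continuous fun p : MatTuple g n × MatTuple g n × MatTuple g n =>
      upperBlock p.1 p.2.1 p.2.2 := by
  refine continuous_pi fun j => Continuous.matrix_reindex (Continuous.matrix_fromBlocks ?_ ?_ ?_ ?_)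
    _ _ <;> fun_prop

theorem continuous_upperRight {n : ℕ+} : Continuous (upperRight : MatTuple g (n + n) → _) := by
  refine continuous_pi fun j => continuous_matrix fun a b => ?_
  exact (continuous_apply j).matrix_elem (sumEquiv n n (Sum.inl a)) (sumEquiv n n (Sum.inr b))

/-- The matrix with blocks `a`, `b` multiples of the identity. -/
def blockColumn (n : ℕ+) (a b : ℂ) : Matrix (Fin (n + n : ℕ+)) (Fin n) ℂ :=
  (Matrix.fromRows (a • (1 : Matrix (Fin n) (Fin n) ℂ)) (b • 1)).submatrix (sumEquiv n n).symm id

theorem upperBlock_mul_blockColumn {n : ℕ+} (X H Y : MatTuple g n) (a b : ℂ) (j : Fin g) :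
    upperBlock X H Y j * blockColumn n a b =
      (Matrix.fromRows (a • X j + b • H j) (b • Y j)).submatrix (sumEquiv n n).symm id := by
  rw [upperBlock, blockColumn, Matrix.reindex_apply, Matrix.submatrix_mul_equiv,
    Matrix.fromBlocks_mul_fromRows]
  simp

theorem blockColumn_mul {n : ℕ+} (Y : Matrix (Fin n) (Fin n) ℂ) (a b : ℂ) :
    blockColumn n a b * Y =
      (Matrix.fromRows (a • Y) (b • Y)).submatrix (sumEquiv n n).symm id := by
  have : Y = Y.submatrix id id := rfl
  conv_lhs => rw [this]
  rw [blockColumn, ← Matrix.submatrix_mul _ _ _ _ _ Function.bijective_id, Matrix.fromRows_mul]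
  simp

theorem mul_blockColumn_apply_inl {n : ℕ+} (Z : MatTuple g (n + n)) (j : Fin g) (a b : ℂ)
    (i k : Fin n) :
    (Z j * blockColumn n a b) (sumEquiv n n (Sum.inl i)) k =
      a * Z j (sumEquiv n n (Sum.inl i)) (sumEquiv n n (Sum.inl k)) + b * upperRight Z j i k := by
  rw [Matrix.mul_apply, ← (sumEquiv n n).sum_comp]
  simp only [blockColumn, upperRight, Matrix.submatrix_apply, Equiv.symm_apply_apply,
    Fintype.sum_sum_type, Matrix.fromRows_apply_inl, Matrix.fromRows_apply_inr, id,
    Matrix.smul_apply, Matrix.one_apply, smul_eq_mul, mul_ite, mul_one, mul_zero,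
    Finset.sum_ite_eq', Finset.mem_univ, if_true, Matrix.of_apply]
  rw [mul_comm a, mul_comm b]

variable {D : (n : ℕ+) → Set (MatTuple g n)} {f : (n : ℕ+) → MatTuple g n → MatTuple h n}

/-- The upper right block of a free map evaluated at a block upper triangular point is a difference
quotient. -/
theorem IsFreeMap.upperRight_apply (hf : IsFreeMap D f) {n : ℕ+} {X Y H : MatTuple g n}
    (hX : X ∈ D n) (hY : Y ∈ D n) (hB : upperBlock X H Y ∈ D (n + n)) {c : ℂ}
    (hH : H = c • (Y - X)) :
    upperRight (f (n + n) (upperBlock X H Y)) = c • (f n Y - f n X) := by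
  have h1 := hf (n + n) n _ hB X hX (blockColumn n 1 0) fun j => by
    rw [upperBlock_mul_blockColumn, blockColumn_mul]
    simp
  -- The relation `H = c • (Y - X)` is exactly what makes the column with blocks `c • 1`, `1`
  -- intertwine the block matrix with `Y`.
  have h2 := hf (n + n) n _ hB Y hY (blockColumn n c 1) fun j => by
    rw [upperBlock_mul_blockColumn, blockColumn_mul]
    simp [hH, smul_sub]
  funext j
  ext i k
  have h1' := congrFun (congrFun (h1 j) (sumEquiv n n (Sum.inl i))) k
  have h2' := congrFun (congrFun (h2 j) (sumEquiv n n (Sum.inl i))) k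
  rw [mul_blockColumn_apply_inl, blockColumn_mul] at h1' h2'
  simp only [Matrix.submatrix_apply, Equiv.symm_apply_apply, Matrix.fromRows_apply_inl, id,
    Matrix.smul_apply, smul_eq_mul, one_mul, zero_mul, add_zero] at h1' h2'
  rw [h1'] at h2'
  simp only [Pi.smul_apply, Pi.sub_apply, Matrix.smul_apply, Matrix.sub_apply, smul_eq_mul]
  linear_combination h2'

/-- Continuous free maps are complex differentiable along lines. -/
theorem IsFreeMap.lineDifferentiableAt (hf : IsFreeMap D f) (hD : IsNCDomain D)
    (hc : IsContinuous D f) {n : ℕ+} {X : MatTuple g n} (hX : X ∈ D n) (V : MatTuple g n) :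
    LineDifferentiableAt ℂ (f n) X V := by
  have hcb : Continuous fun p : ℂ × ℂ => upperBlock X (p.1 • V) (X + p.2 • V) :=
    continuous_upperBlock.comp (f := fun p : ℂ × ℂ => (X, p.1 • V, X + p.2 • V)) (by fun_prop)
  have hmem0 : ∀ᶠ p in 𝓝 ((0 : ℂ), (0 : ℂ)),
      upperBlock X (p.1 • V) (X + p.2 • V) ∈ D (n + n) := by
    refine hcb.continuousAt.eventually_mem ((hD.isOpen _).mem_nhds ?_)
    simpa [upperBlock_zero] using hD.directSum_mem n n X X hX hX
  have hcur := hmem0.curry_nhds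
  -- The corner must be small for the point to lie in the open set `D (n + n)` around `X ⊕ X`. A
  -- nonzero `δ` is fixed first, and only then does `t` tend to `0`.
  obtain ⟨δ, hδ, hδ0⟩ : ∃ δ : ℂ, (∀ᶠ t in 𝓝 (0 : ℂ),
      upperBlock X (δ • V) (X + t • V) ∈ D (n + n)) ∧ δ ≠ 0 := by
    have h1 : ∀ᶠ δ in 𝓝[≠] (0 : ℂ), ∀ᶠ t in 𝓝 (0 : ℂ),
      upperBlock X (δ • V) (X + t • V) ∈ D (n + n) := hcur.filter_mono nhdsWithin_le_nhds
    exact (h1.and self_mem_nhdsWithin).exists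
  have hline : ∀ᶠ t in 𝓝 (0 : ℂ), X + t • V ∈ D n := by
    have : Continuous fun t : ℂ => X + t • V := by fun_prop
    refine this.continuousAt.eventually_mem ((hD.isOpen _).mem_nhds ?_)
    simpa using hX
  let Q : ℂ → MatTuple h n := fun t => upperRight (f (n + n) (upperBlock X (δ • V) (X + t • V)))
  have hQ : Tendsto Q (𝓝 0) (𝓝 (Q 0)) := by
    have h1 : ContinuousAt (f (n + n)) (upperBlock X (δ • V) (X + (0 : ℂ) • V)) :=
      (hc _).continuousAt ((hD.isOpen _).mem_nhds hδ.self_of_nhds)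
    have h2 : ContinuousAt (fun t : ℂ => upperBlock X (δ • V) (X + t • V)) 0 :=
      (hcb.comp (Continuous.prodMk_right δ)).continuousAt
    exact (continuous_upperRight.continuousAt.comp
      (ContinuousAt.comp (x := (0 : ℂ)) (f := fun t : ℂ => upperBlock X (δ • V) (X + t • V))
        h1 h2)).tendsto
  refine HasLineDerivAt.lineDifferentiableAt (f' := δ⁻¹ • Q 0) ?_
  rw [HasLineDerivAt, hasDerivAt_iff_tendsto_slope]
  refine ((hQ.const_smul δ⁻¹).mono_left nhdsWithin_le_nhds).congr' ?_
  filter_upwards [nhdsWithin_le_nhds hδ, nhdsWithin_le_nhds hline, self_mem_nhdsWithin]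
    with t ht htD ht0
  have ht0' : t ≠ 0 := ht0
  simp only [Q]
  rw [hf.upperRight_apply hX htD ht (c := δ * t⁻¹)]
  · rw [slope_def_module, zero_smul, add_zero, sub_zero, smul_smul, inv_mul_cancel_left₀ hδ0]
  · rw [add_sub_cancel_left, smul_smul, inv_mul_cancel_right₀ ht0']

theorem IsFreeMap.isAnalytic (hf : IsFreeMap D f) (hD : IsNCDomain D) (hc : IsContinuous D f) :
    IsAnalytic D f := fun n =>
  analyticOnNhd_of_continuousOn_of_lineDifferentiable (hD.isOpen n) (hc n)
    fun _ hX V => hf.lineDifferentiableAt hD hc hX V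

variable {φ : (n : ℕ+) → MatTuple g n → MatTuple g n}

theorem IsFreeMap.iterate (hf : IsFreeMap D φ) (hself : ∀ n, Set.MapsTo (φ n) (D n) (D n)) (k : ℕ) :
    IsFreeMap D fun n => (φ n)^[k] := by
  induction k with
  | zero => exact fun n m X _ Y _ Γ h => h
  | succ k ih =>
    intro n m X hX Y hY Γ h
    simp only [Function.iterate_succ_apply']
    exact hf n m _ ((hself n).iterate k hX) _ ((hself m).iterate k hY) Γ (ih n m X hX Y hY Γ h)

theorem IsContinuous.iterate (hc : IsContinuous D φ)
    (hself : ∀ n, Set.MapsTo (φ n) (D n) (D n)) (k : ℕ) :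
    IsContinuous D fun n => (φ n)^[k] := fun n => (hc n).iterate (hself n) k

theorem matTuple_one_ext {x y : MatTuple g 1} (h : ∀ k, x k 0 0 = y k 0 0) : x = y := by
  have : Subsingleton (Fin (1 : ℕ+)) := inferInstanceAs (Subsingleton (Fin 1))
  funext k
  ext i i'
  rw [Subsingleton.elim i 0, Subsingleton.elim i' 0, h]

/-- The tuple of the `(a, b)` entries. -/
def entry {n : ℕ+} (a b : Fin n) : MatTuple g n →ₗ[ℂ] MatTuple g 1 where
  toFun X := fun k => Matrix.of fun _ _ => X k a b
  map_add' _ _ := rfl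
  map_smul' _ _ := rfl

/-- The entrywise action on tuples of `n × n` matrices of a linear map on tuples of scalars. -/
noncomputable def ampliation (n : ℕ+) :
    (MatTuple g 1 →L[ℂ] MatTuple g 1) →ₐ[ℂ] (MatTuple g n →L[ℂ] MatTuple g n) :=
  AlgHom.ofLinearMap
    { toFun := fun A => LinearMap.toContinuousLinearMap
        { toFun := fun X j => Matrix.of fun a b => A (entry a b X) j 0 0
          map_add' := fun X Y => by
            simp only [map_add]
            rfl
          map_smul' := fun c X => by
            simp only [map_smul]
            rfl }
      map_add' := fun A B => rfl
      map_smul' := fun c A => rfl }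
    rfl
    fun A B => by
      ext X j a b
      have : (fun k => Matrix.of fun _ _ => B (entry a b X) k 0 0 : MatTuple g 1) =
          B (entry a b X) := matTuple_one_ext fun k => rfl
      exact congrArg (fun Y => A Y j 0 0) this.symm

theorem ampliation_apply {n : ℕ+} (A : MatTuple g 1 →L[ℂ] MatTuple g 1) (X : MatTuple g n)
    (j : Fin g) (a b : Fin n) : ampliation n A X j a b = A (entry a b X) j 0 0 := rfl

end FreeMap

/-! ### The derivative at zero is determined by the scalar level. -/

namespace FreeMap

open Filter Topology Matrix Set

variable {g : ℕ} {D : (n : ℕ+) → Set (MatTuple g n)}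
  {f : (n : ℕ+) → MatTuple g n → MatTuple g n}

/-- The derivatives at `0` of a free map respect intertwining maps. -/
theorem IsFreeMap.fderiv_zero_mul (hf : IsFreeMap D f) (hD : ∀ n, D n ∈ 𝓝 0)
    (hd : ∀ n, DifferentiableAt ℂ (f n) 0) (h0 : ∀ n, f n 0 = 0) {n m : ℕ+} {X : MatTuple g n}
    {Y : MatTuple g m} {Γ : Matrix (Fin n) (Fin m) ℂ} (h : ∀ j, X j * Γ = Γ * Y j) (j : Fin g) :
    fderiv ℂ (f n) 0 X j * Γ = Γ * fderiv ℂ (f m) 0 Y j := by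
  have hlim : ∀ (k : ℕ+) (Z : MatTuple g k),
      Tendsto (fun t : ℂ => t⁻¹ • f k (t • Z)) (𝓝[≠] 0) (𝓝 (fderiv ℂ (f k) 0 Z)) := by
    intro k Z
    simpa [h0] using! ((hd k).hasFDerivAt.hasLineDerivAt Z).tendsto_slope_zero
  have hmem : ∀ (k : ℕ+) (Z : MatTuple g k), ∀ᶠ t : ℂ in 𝓝[≠] 0, t • Z ∈ D k := by
    intro k Z
    have : Continuous fun t : ℂ => t • Z := by fun_prop
    exact nhdsWithin_le_nhds (this.continuousAt.eventually_mem (by simpa using hD k))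
  have hcl : Continuous fun Z : MatTuple g n => Z j * Γ :=
    Continuous.matrix_mul (continuous_apply j) continuous_const
  have hcr : Continuous fun Z : MatTuple g m => Γ * Z j :=
    Continuous.matrix_mul continuous_const (continuous_apply j)
  have hl : Tendsto (fun t : ℂ => (t⁻¹ • f n (t • X)) j * Γ) (𝓝[≠] 0)
      (𝓝 (fderiv ℂ (f n) 0 X j * Γ)) := (hcl.tendsto _).comp (hlim n X)
  have hr : Tendsto (fun t : ℂ => Γ * (t⁻¹ • f m (t • Y)) j) (𝓝[≠] 0)
      (𝓝 (Γ * fderiv ℂ (f m) 0 Y j)) := (hcr.tendsto _).comp (hlim m Y)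
  refine tendsto_nhds_unique_of_eventuallyEq hl hr ?_
  filter_upwards [hmem n X, hmem m Y] with t hX hY
  have := hf n m _ hX _ hY Γ (fun i => by
    rw [Pi.smul_apply, Pi.smul_apply, Matrix.smul_mul, Matrix.mul_smul, h i]) j
  rw [Pi.smul_apply, Pi.smul_apply, Matrix.smul_mul, Matrix.mul_smul, this]

/-- The tuple with entries the scalar multiples of a matrix. -/
def scalarTuple {n : ℕ+} (x : MatTuple g 1) : Matrix (Fin n) (Fin n) ℂ →ₗ[ℂ] MatTuple g n where
  toFun M := fun k => x k 0 0 • M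
  map_add' _ _ := funext fun _ => smul_add _ _ _
  map_smul' _ _ := funext fun _ => smul_comm _ _ _

theorem sum_scalarTuple_entry {n : ℕ+} (X : MatTuple g n) :
    ∑ a, ∑ b, scalarTuple (entry a b X) (Matrix.single a b 1) = X := by
  funext k
  conv_rhs => rw [Matrix.matrix_eq_sum_single (X k)]
  simp only [Finset.sum_apply]
  refine Finset.sum_congr rfl fun a _ => Finset.sum_congr rfl fun b _ => ?_
  change X k a b • Matrix.single a b (1 : ℂ) = _
  simp

theorem ampliation_scalarTuple {n : ℕ+} (A : MatTuple g 1 →L[ℂ] MatTuple g 1) (x : MatTuple g 1)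
    (M : Matrix (Fin n) (Fin n) ℂ) : ampliation n A (scalarTuple x M) = scalarTuple (A x) M := by
  funext j
  ext a b
  have : entry a b (scalarTuple x M) = M a b • x := matTuple_one_ext fun k => mul_comm _ _
  rw [ampliation_apply, this, map_smul]
  exact mul_comm _ _

theorem replicateCol_mul_matrix_one {n : ℕ+} (u : Fin n → ℂ)
    (Y : Matrix (Fin (1 : ℕ+)) (Fin (1 : ℕ+)) ℂ) :
    replicateCol (Fin (1 : ℕ+)) u * Y = replicateCol (Fin (1 : ℕ+)) (Y 0 0 • u) := by
  have : Subsingleton (Fin (1 : ℕ+)) := inferInstanceAs (Subsingleton (Fin 1))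
  ext a i
  rw [Subsingleton.elim i 0, Matrix.mul_apply]
  exact (Fin.sum_univ_one _).trans (mul_comm _ _)

/-- The derivative at `0` of a free map is determined by the derivative at the scalar level. -/
theorem IsFreeMap.fderiv_zero_eq_ampliation (hf : IsFreeMap D f) (hD : ∀ n, D n ∈ 𝓝 0)
    (hd : ∀ n, DifferentiableAt ℂ (f n) 0) (h0 : ∀ n, f n 0 = 0) (n : ℕ+) :
    fderiv ℂ (f n) 0 = ampliation n (fderiv ℂ (f 1) 0) := by
  set L := fderiv ℂ (f n) 0 with hL
  set A := fderiv ℂ (f 1) 0 with hA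
  -- For a rank one idempotent `u vᵀ`, the column `u` intertwines the tuple with `x`, and each `w`
  -- in the kernel of `vᵀ` intertwines it with `0`. Such columns span, so they determine the image
  -- under `L`.
  have hrank : ∀ (x : MatTuple g 1) (u v : Fin n → ℂ), v ⬝ᵥ u = 1 →
      L (scalarTuple x (vecMulVec u v)) = scalarTuple (A x) (vecMulVec u v) := by
    intro x u v huv
    have hcol : ∀ (k : Fin g) (w : Fin n → ℂ),
        (scalarTuple x (vecMulVec u v) : MatTuple g n) k *ᵥ w = (x k 0 0 * (v ⬝ᵥ w)) • u := by
      intro k w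
      change (x k 0 0 • vecMulVec u v) *ᵥ w = _
      rw [Matrix.smul_mulVec, Matrix.vecMulVec_mulVec, op_smul_eq_smul, smul_smul]
    have hu : ∀ j, L (scalarTuple x (vecMulVec u v)) j *ᵥ u = A x j 0 0 • u := by
      intro j
      have := hf.fderiv_zero_mul hD hd h0 (X := scalarTuple x (vecMulVec u v)) (Y := x)
        (Γ := replicateCol _ u) (fun k => by
          rw [← replicateCol_mulVec, hcol, huv, mul_one, replicateCol_mul_matrix_one]) j
      rw [← replicateCol_mulVec, replicateCol_mul_matrix_one] at this
      exact replicateCol_injective this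
    have hw : ∀ (j : Fin g) (w : Fin n → ℂ), v ⬝ᵥ w = 0 →
        L (scalarTuple x (vecMulVec u v)) j *ᵥ w = 0 := by
      intro j w hvw
      have := hf.fderiv_zero_mul hD hd h0 (X := scalarTuple x (vecMulVec u v))
        (Y := (0 : MatTuple g 1)) (Γ := replicateCol _ w) (fun k => by
          rw [← replicateCol_mulVec, hcol, hvw, mul_zero, zero_smul, Pi.zero_apply,
            Matrix.mul_zero, replicateCol_zero]) j
      rw [← replicateCol_mulVec, map_zero, Pi.zero_apply, Matrix.mul_zero,
        ← replicateCol_zero] at this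
      exact replicateCol_injective this
    funext j
    refine Matrix.ext_of_mulVec_single fun b => ?_
    have hdec : Pi.single b (1 : ℂ) = v b • u + (Pi.single b 1 - v b • u) := by abel
    have hright : (scalarTuple (A x) (vecMulVec u v) : MatTuple g n) j *ᵥ Pi.single b 1 =
        (v b * A x j 0 0) • u := by
      change (A x j 0 0 • vecMulVec u v) *ᵥ Pi.single b 1 = _
      rw [Matrix.smul_mulVec, Matrix.vecMulVec_mulVec, op_smul_eq_smul, smul_smul]
      simp [mul_comm]
    rw [hright, hdec, Matrix.mulVec_add, Matrix.mulVec_smul, hu, hw, smul_smul, add_zero]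
    · simp [dotProduct_sub, huv]
  have hsingle : ∀ (x : MatTuple g 1) (a b : Fin n),
      L (scalarTuple x (Matrix.single a b 1)) = scalarTuple (A x) (Matrix.single a b 1) := by
    intro x a b
    have haa := hrank x (Pi.single a 1) (Pi.single a 1) (by simp)
    have hsv : ∀ a b : Fin n, vecMulVec (Pi.single a (1 : ℂ)) (Pi.single b 1) =
        Matrix.single a b 1 := fun a b => by
      rw [Matrix.single_eq_single_vecMulVec_single]
    rcases eq_or_ne a b with rfl | hab
    · simpa only [hsv] using haa
    -- An off-diagonal matrix unit is not idempotent, but it is the difference of the idempotents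
    -- `e_a (e_a + e_b)ᵀ` and `e_a e_aᵀ`.
    · have hab' := hrank x (Pi.single a 1) (Pi.single a 1 + Pi.single b 1) (by
        simp [hab])
      rw [Matrix.vecMulVec_add, map_add, map_add, map_add, haa] at hab'
      simpa only [hsv, add_right_inj] using hab'
  ext X : 1
  rw [← sum_scalarTuple_entry X]
  simp only [map_sum, hsingle, ampliation_scalarTuple]

/-- Each diagonal entry of the positive definite matrix is `C ^ 2` minus a sum of squared moduli
over a row of every `X j`, so every entry is at most `|C|` in modulus. -/
theorem IsBounded.exists_norm_le (h : IsBounded D) : ∃ M : ℝ, ∀ n, ∀ X ∈ D n, ‖X‖ ≤ M := by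
  obtain ⟨C, hC⟩ := h
  refine ⟨|C|, fun n X hX => ?_⟩
  rw [pi_norm_le_iff_of_nonneg (abs_nonneg C)]
  intro j
  rw [Matrix.norm_le_iff (abs_nonneg C)]
  intro a b
  have h1 := (hC n X hX).diag_pos (i := a)
  have h2 : ((∑ j, ∑ b, ‖X j a b‖ ^ 2 : ℝ) : ℂ) = (∑ j, X j * (X j)ᴴ) a a := by
    rw [Matrix.sum_apply]
    push_cast
    refine Finset.sum_congr rfl fun j _ => ?_
    rw [Matrix.mul_apply]
    refine Finset.sum_congr rfl fun b _ => ?_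
    rw [Matrix.conjTranspose_apply, Complex.star_def, Complex.mul_conj']
  rw [Matrix.sub_apply, ← h2, Matrix.smul_apply, Matrix.one_apply_eq, smul_eq_mul, mul_one,
    ← Complex.ofReal_pow, ← Complex.ofReal_sub, Complex.zero_lt_real, sub_pos] at h1
  rw [← abs_norm (X j a b)]
  refine sq_le_sq.1 (le_trans ?_ h1.le)
  calc ‖X j a b‖ ^ 2 ≤ ∑ b, ‖X j a b‖ ^ 2 :=
        Finset.single_le_sum (f := fun b => ‖X j a b‖ ^ 2) (fun _ _ => by positivity)
          (Finset.mem_univ b)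
    _ ≤ ∑ j, ∑ b, ‖X j a b‖ ^ 2 :=
        Finset.single_le_sum (f := fun j => ∑ b, ‖X j a b‖ ^ 2) (fun _ _ => by positivity)
          (Finset.mem_univ j)

end FreeMap

/-! ### Convergence of iterates at every level and the main theorem. -/

namespace FreeMap

open Filter Topology Matrix Set

variable {g : ℕ} {D : (n : ℕ+) → Set (MatTuple g n)}
  {f : (n : ℕ+) → MatTuple g n → MatTuple g n}

/-- Every column intertwines the zero tuples of sizes `n` and `1`, so `f n 0` annihilates each basis
vector. -/
theorem IsFreeMap.apply_zero (hf : IsFreeMap D f) (hD : ∀ n, 0 ∈ D n) (h0 : f 1 0 = 0) (n : ℕ+) :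
    f n 0 = 0 := by
  funext j
  refine Matrix.ext_of_mulVec_single fun b => ?_
  have := hf n 1 0 (hD n) 0 (hD 1) (replicateCol _ (Pi.single b 1)) (fun k => by
    rw [Pi.zero_apply, Pi.zero_apply, Matrix.zero_mul, Matrix.mul_zero]) j
  rw [h0, ← replicateCol_mulVec, Pi.zero_apply, Matrix.mul_zero, ← replicateCol_zero] at this
  rw [Pi.zero_apply, Matrix.zero_mulVec]
  exact replicateCol_injective this

theorem differentiableOn_iterate (hD : IsNCDomain D) (hself : ∀ n, MapsTo (f n) (D n) (D n))
    (hf : IsFreeMap D f) (hc : IsContinuous D f) (n : ℕ+) (k : ℕ) :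
    DifferentiableOn ℂ (f n)^[k] (D n) :=
  ((hf.iterate hself k).isAnalytic hD (hc.iterate hself k) n).differentiableOn

theorem isPowerBounded_fderiv_zero (hD : IsNCDomain D) (hb : IsBounded D) (h0 : ∀ n, 0 ∈ D n)
    (hself : ∀ n, MapsTo (f n) (D n) (D n)) (hf : IsFreeMap D f) (hc : IsContinuous D f)
    (hfix : f 1 0 = 0) : IsPowerBounded (E := MatTuple g 1) (fderiv ℂ (f 1) 0) := by
  obtain ⟨M, hM⟩ := hb.exists_norm_le
  have hD0 := (hD.isOpen 1).mem_nhds (h0 1)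
  exact isPowerBounded_of_hasFDerivAt hD0 (hM 1) (hself 1)
    (differentiableOn_iterate hD hself hf hc 1) hfix
    ((hf.isAnalytic hD hc 1).differentiableOn.differentiableAt hD0).hasFDerivAt

/-- If powers of the derivative at the scalar level converge to the identity, so do the
corresponding iterates at every level. -/
theorem exists_tendstoUniformlyOn_iterate_level (hD : IsNCDomain D) (hb : IsBounded D)
    (h0 : ∀ n, 0 ∈ D n) (hself : ∀ n, MapsTo (f n) (D n) (D n)) (hf : IsFreeMap D f)
    (hc : IsContinuous D f) (hfix : f 1 0 = 0) {B : MatTuple g 1 →L[ℂ] MatTuple g 1}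
    (hAB : fderiv ℂ (f 1) 0 * B = 1) (hBA : B * fderiv ℂ (f 1) 0 = 1)
    (hB : IsPowerBounded (E := MatTuple g 1) B)
    {p : ℕ → ℕ} (hp : Tendsto (fun i => fderiv ℂ (f 1) 0 ^ p i) atTop (𝓝 1)) (n : ℕ+)
    {X : MatTuple g n} (hX : X ∈ D n) :
    ∃ r > 0, TendstoUniformlyOn (fun i Y => (f n)^[p i] Y - Y) 0 atTop (Metric.ball X r) := by
  obtain ⟨M, hM⟩ := hb.exists_norm_le
  have hnhds : ∀ n, D n ∈ 𝓝 0 := fun n => (hD.isOpen n).mem_nhds (h0 n)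
  have hd : ∀ n, DifferentiableAt ℂ (f n) 0 := fun n =>
    (hf.isAnalytic hD hc n).differentiableOn.differentiableAt (hnhds n)
  have hA : HasFDerivAt (f n) (ampliation n (fderiv ℂ (f 1) 0)) 0 := by
    rw [← hf.fderiv_zero_eq_ampliation hnhds hd (hf.apply_zero h0 hfix)]
    exact (hd n).hasFDerivAt
  have hAB' : ampliation n (fderiv ℂ (f 1) 0) * ampliation n B = 1 := by
    rw [← map_mul, hAB, map_one]
  have hBA' : ampliation n B * ampliation n (fderiv ℂ (f 1) 0) = 1 := by
    rw [← map_mul, hBA, map_one]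
  exact exists_tendstoUniformlyOn_iterate_ball (B := ampliation n B)
    (hD.isOpen n) (hD.isConnected n).isPreconnected (hM n) (h0 n) (hself n)
    (differentiableOn_iterate hD hself hf hc n) (hf.apply_zero h0 hfix n) hA hAB' hBA'
    (hB.map (ampliation n)) (tendsto_algHom_pow hp (ampliation n)) hX

theorem isCompact_inter_preimage_of_invOn {α : Type*} [TopologicalSpace α] {φ ψ : α → α}
    {s K : Set α} (hψ : MapsTo ψ s s) (h : InvOn ψ φ s s)
    (hc : ContinuousOn ψ s) (hKs : K ⊆ s) (hK : IsCompact K) : IsCompact (s ∩ φ ⁻¹' K) := by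
  have : s ∩ φ ⁻¹' K = ψ '' K := by
    ext x
    constructor
    · rintro ⟨hx, hxK⟩
      exact ⟨φ x, hxK, h.1 hx⟩
    · rintro ⟨y, hy, rfl⟩
      refine ⟨hψ (hKs hy), ?_⟩
      rwa [mem_preimage, h.2 (hKs hy)]
  rw [this]
  exact hK.image_of_continuousOn (hc.mono hKs)

/-- A continuous free self-map is bianalytic if some of its iterates converge locally uniformly to
the identity at every level. -/
theorem isBianalyticFreeMap_of_tendstoUniformlyOn_iterate (hD : IsNCDomain D)
    (hself : ∀ n, MapsTo (f n) (D n) (D n)) (hf : IsFreeMap D f) (hc : IsContinuous D f)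
    {p : ℕ → ℕ} (hp : ∀ i, 0 < p i)
    (hl : ∀ n, ∀ X ∈ D n, ∃ r > 0,
      TendstoUniformlyOn (fun i Y => (f n)^[p i] Y - Y) 0 atTop (Metric.ball X r)) :
    IsBianalyticFreeMap D D f := by
  choose ψ hψmaps hψinv hψcont using fun n =>
    exists_continuousOn_inverse_of_tendstoUniformlyOn_iterate (hD.isOpen n) (hself n)
      (differentiableOn_iterate hD hself hf hc n) hp (hl n)
  have hpt : ∀ n, ∀ X ∈ D n, Tendsto (fun i => (f n)^[p i] X) atTop (𝓝 X) := by
    intro n X hX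
    obtain ⟨r, hr, h⟩ := hl n X hX
    have := (h.tendsto_at (Metric.mem_ball_self hr)).add_const X
    simpa using this
  -- Since `f (ψ X) = X`, the iterate `f^[p i]` at `ψ X` is `f^[p i - 1]` at `X`; positivity of `p
  -- i` matters here.
  have hψlim : ∀ n, ∀ X ∈ D n, Tendsto (fun i => (f n)^[p i - 1] X) atTop (𝓝 (ψ n X)) := by
    intro n X hX
    refine (hpt n _ (hψmaps n hX)).congr fun i => ?_
    conv_lhs => rw [← Nat.sub_add_cancel (hp i), Function.iterate_succ_apply, (hψinv n).2 hX]
  have hψfree : IsFreeMap D ψ := by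
    intro n m X hX Y hY Γ h j
    have hcl : Continuous fun Z : MatTuple g n => Z j * Γ :=
      Continuous.matrix_mul (continuous_apply j) continuous_const
    have hcr : Continuous fun Z : MatTuple g m => Γ * Z j :=
      Continuous.matrix_mul continuous_const (continuous_apply j)
    refine tendsto_nhds_unique ((hcl.tendsto _).comp (hψlim n X hX))
      (((hcr.tendsto _).comp (hψlim m Y hY)).congr fun i => ?_)
    exact (hf.iterate hself (p i - 1) n m X hX Y hY Γ h j).symm
  refine ⟨⟨hself, hf, hf.isAnalytic hD hc, fun n K hK hKc => ?_⟩, ψ,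
    ⟨hψmaps, hψfree, hψfree.isAnalytic hD hψcont, fun n K hK hKc => ?_⟩, hψinv⟩
  · exact isCompact_inter_preimage_of_invOn (hψmaps n) (hψinv n) (hψcont n) hK hKc
  · exact isCompact_inter_preimage_of_invOn (hself n) (hψinv n).symm (hc n) hK hKc

end FreeMap

theorem mainTheorem3 (g : ℕ) (hg : 0 < g)
    (D : (n : ℕ+) → Set (FreeMap.MatTuple g n))
    (hD : FreeMap.IsNCDomain D) (hbdd : FreeMap.IsBounded D) (hzero : ∀ n, 0 ∈ D n)
    (f : (n : ℕ+) → FreeMap.MatTuple g n → FreeMap.MatTuple g n)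
    (hself : ∀ n, Set.MapsTo (f n) (D n) (D n))
    (hfree : FreeMap.IsFreeMap D f) (hcont : FreeMap.IsContinuous D f)
    (hfix : f 1 0 = 0) :
    DifferentiableAt ℂ (f 1) 0 ∧
    ((∀ μ : ℂ, Module.End.HasEigenvalue
          (fderiv ℂ (f 1) 0 : FreeMap.MatTuple g 1 →ₗ[ℂ] FreeMap.MatTuple g 1) μ → ‖μ‖ = 1) →
        FreeMap.IsBianalyticFreeMap D D f) ∧
    (fderiv ℂ (f 1) 0 = ContinuousLinearMap.id ℂ (FreeMap.MatTuple g 1) →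
        ∀ n, ∀ X ∈ D n, f n X = X) := by
  refine ⟨(hfree.isAnalytic hD hcont 1).differentiableOn.differentiableAt
    ((hD.isOpen 1).mem_nhds (hzero 1)), fun hev => ?_, fun hid n X hX => ?_⟩
  · obtain ⟨B, hAB, hBA, hB, p, hp, hlim⟩ := (FreeMap.isPowerBounded_fderiv_zero hD hbdd hzero
      hself hfree hcont hfix).exists_inverse hev
    exact FreeMap.isBianalyticFreeMap_of_tendstoUniformlyOn_iterate hD hself hfree hcont hp
      fun n X hX => FreeMap.exists_tendstoUniformlyOn_iterate_level hD hbdd hzero hself hfree hcont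
        hfix hAB hBA hB hlim n hX
  · have hone : fderiv ℂ (f 1) 0 = 1 := hid
    have hB : IsPowerBounded (E := FreeMap.MatTuple g 1) 1 := ⟨_, fun k => by rw [one_pow]⟩
    -- With `p` constantly `1` the convergent sequence is the constant `f n X - X`, which must equal
    -- its limit `0`.
    obtain ⟨r, hr, h⟩ := FreeMap.exists_tendstoUniformlyOn_iterate_level hD hbdd hzero hself hfree
      hcont hfix (B := 1) (p := fun _ => 1) (by rw [hone, one_mul]) (by rw [hone, one_mul]) hB
      (by simp only [hone, one_pow, tendsto_const_nhds]) n hX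
    exact sub_eq_zero.1 (tendsto_nhds_unique tendsto_const_nhds
      (h.tendsto_at (Metric.mem_ball_self hr)))
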